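/- Consider $2^{\mathbb N\times\mathbb N}$ and $2^{\mathbb N}$ with their uniform (fair-coin) measures $\mathbb P$. *Doob randomness.* For $\omega,\xi\in 2^{\mathbb N\times\mathbb N}$ let $\omega_{<m}{}^\frown\xi$ be the array whose first $m$ rows are those of $\omega$, followed by the rows of $\xi$, and let $\mathbb E_m(g)(\omega)=\int g(\omega_{<m}{}^\frown\xi)\,d\mathbb P(\xi)$. A martingale on $2^{\mathbb N\times\mathbb N}$ is a sequence $(M_n)_{n\in\mathbb N}$ of integrable functions $M_n:2^{\mathbb N\times\mathbb N}\to\mathbb R$ such that, almost surely, $M_n(\omega)$ depends only on $n$ and the first $n$ rows of $\omega$, and $\mathbb E_m(M_n)=M_m$ for all $m\le n$. It is computable if $M_n(\omega)$ is computable uniformly from $n$ and $\omega$ (an algorithm reading the bits of $\omega$ produces a Cauchy name of $M_n(\omega)$). An array $\omega$ is *Doob random* if $(M_n(\omega))_n$ converges in $\mathbb R$ for every nonnegative computable martingale $(M_n)$. *Uniform relative computable randomness.* A martingale on $2^{\mathbb N}$ is a sequence of integrable functions $M_n:2^{\mathbb N}\to\mathbb R$ such that $M_n(\alpha)$ depends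 only on $n$ and the first $n$ bits of $\alpha$, and, for all $m\le n$ and $\alpha$, $\int M_n(\alpha_{<m}{}^\frown\beta)\,d\mathbb P(\beta)=M_m(\alpha)$. A uniform martingale test is a family $(M^\gamma)_{\gamma\in2^{\mathbb N}}$ of nonnegative martingales on $2^{\mathbb N}$ for which some total computable $\Phi:2^{\mathbb N}\to\mathbb N^{\mathbb N}$ has each $\Phi(\gamma)$ encoding $M^\gamma$ (that is, giving Cauchy names of the values $M^\gamma_n(\alpha)$ as functions of $\alpha_{<n}$). A sequence $\alpha\in2^{\mathbb N}$ is *computably random uniformly relative to* $\beta\in2^{\mathbb N}$ if there is no uniform martingale test with $\limsup_n M^\beta_n(\alpha)=\infty$. For computable $f:\mathbb N\to\mathbb N$ let $A_f=\{(m,n): n\ge f(m)\}$ and $B_f=\{(m,n): n<f(m)\}$ (the positions above and below $f$). For an infinite computable set $C\subseteq\mathbb N\times\mathbb N$, a computable ordering of $C$ is a computable injective $e:\mathbb N\to\mathbb N\times\mathbb N$ with range $C$, and $\omega_C=(\omega_{e(0)},\omega_{e(1)},\dots)$. **Theorem.** (i) For every computable $f$ with $B_f$ infinite, both $A_f$ and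 $B_f$ have computable orderings, and for every $\omega\in 2^{\mathbb N\times\mathbb N}$ whether $\omega_{B_f}$ is computably random uniformly relative to $\omega_{A_f}$ does not depend on the computable orderings chosen for $A_f$ and $B_f$. (ii) Each $\omega\in2^{\mathbb N\times\mathbb N}$ is Doob random if and only if, for every computable $f:\mathbb N\to\mathbb N$ with $B_f$ infinite (and any computable orderings of $A_f$ and $B_f$), $\omega_{B_f}$ is computably random uniformly relative to $\omega_{A_f}$. -/

import Mathlib

open MeasureTheory Filter Topology

namespace DoobRand

/-! ### The spaces and their uniform measures -/

/-- Infinite bit sequences. -/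
abbrev Cantor : Type := ℕ → Bool

/-- Bit arrays `ω`; the bit in row `m` and column `n` is `ω (m, n)`. -/
abbrev BitArray : Type := ℕ × ℕ → Bool

/-- The fair-coin (uniform product) measure on `ι → Bool`. -/
noncomputable def uniformMeasure (ι : Type) : Measure (ι → Bool) :=
  Measure.infinitePi fun _ : ι => (PMF.uniformOfFintype Bool).toMeasure

/-! ### Computable functionals and computable real-valued functions -/

/-- The finite string `(γ 0, …, γ (s - 1))`. -/
def initSeg (γ : Cantor) (s : ℕ) : List Bool := (List.range s).map γ

/-- `F γ x` is computable uniformly from the infinite bit sequence `γ` and the discrete input `x`,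
and this computation is total on all of Cantor space: one algorithm, reading longer and longer
finite initial segments of `γ`, eventually answers, and it never gives a wrong answer. -/
def IsComputableFunctional {τ σ : Type} [Primcodable τ] [Primcodable σ]
    (F : Cantor → τ → σ) : Prop :=
  ∃ φ : List Bool × τ → Option σ, Computable φ ∧
    ∀ (γ : Cantor) (x : τ),
      (∃ s, φ (initSeg γ s, x) = some (F γ x)) ∧
      ∀ s y, φ (initSeg γ s, x) = some y → y = F γ x

/-- An enumeration of the rationals (the simple points of the real line): the code
`⟨a, ⟨b, c⟩⟩` denotes `(a - b) / (c + 1)`. -/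
def ratOfCode (i : ℕ) : ℚ :=
  ((i.unpair.1 : ℚ) - (i.unpair.2.unpair.1 : ℚ)) / ((i.unpair.2.unpair.2 : ℚ) + 1)

theorem ratOfCode_surjective : Function.Surjective ratOfCode := by
  intro q
  refine ⟨Nat.pair q.num.toNat (Nat.pair (-q.num).toNat (q.den - 1)), ?_⟩
  have h1 : ((q.num.toNat : ℚ) - ((-q.num).toNat : ℚ)) = (q.num : ℚ) := by
    exact_mod_cast Int.toNat_sub_toNat_neg q.num
  have h2 : ((q.den - 1 : ℕ) : ℚ) + 1 = (q.den : ℚ) := by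
    exact_mod_cast Nat.sub_add_cancel q.pos
  simp only [ratOfCode, Nat.unpair_pair, h1, h2]
  exact Rat.num_div_den q

/-- `p` is a Cauchy name of the real number `x`. -/
def IsCauchyName (p : ℕ → ℕ) (x : ℝ) : Prop :=
  (∀ m n, m ≤ n → |(ratOfCode (p n) : ℝ) - (ratOfCode (p m) : ℝ)| ≤ (1 / 2 : ℝ) ^ m) ∧
    Tendsto (fun n => (ratOfCode (p n) : ℝ)) atTop (𝓝 x)

/-! ### Martingales on Cantor space, uniform relative computable randomness -/

/-- `α_{<n} ⌢ β`. -/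
def seqConcat (α : Cantor) (n : ℕ) (β : Cantor) : Cantor :=
  fun k => if k < n then α k else β (k - n)

/-- The conditional expectation `𝔼ₙ f` on Cantor space. -/
noncomputable def seqCondExp (n : ℕ) (f : Cantor → ℝ) (α : Cantor) : ℝ :=
  ∫ β, f (seqConcat α n β) ∂(uniformMeasure ℕ)

/-- Martingales on Cantor space. -/
structure IsSeqMartingale (M : ℕ → Cantor → ℝ) : Prop where
  integrable : ∀ n, Integrable (M n) (uniformMeasure ℕ)
  adapted : ∀ n, DependsOn (M n) (Set.Iio n)
  condExp_eq : ∀ m n, m ≤ n → seqCondExp m (M n) = M m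

/-- `p` encodes the martingale `M`: on the code of `(σ, k)` it gives the `k`-th entry of a Cauchy
name of the common value `M n α` for all `α` with `α_{<n} = σ`. -/
def EncodesMartingale (p : ℕ → ℕ) (M : ℕ → Cantor → ℝ) : Prop :=
  IsSeqMartingale M ∧
    ∀ (n : ℕ) (α : Cantor), IsCauchyName (fun k => p (Encodable.encode (initSeg α n, k))) (M n α)

/-- A uniform martingale test: a family of nonnegative martingales `M γ`, indexed by all
`γ` in Cantor space, with codes given by a single total computable map. -/
def IsUniformMartingaleTest (M : Cantor → ℕ → Cantor → ℝ) : Prop :=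
  (∀ γ n α, 0 ≤ M γ n α) ∧
    ∃ Φ : Cantor → ℕ → ℕ, IsComputableFunctional Φ ∧ ∀ γ, EncodesMartingale (Φ γ) (M γ)

/-- `α` is computably random uniformly relative to `β`. -/
def ComputablyRandomUniformlyRel (α β : Cantor) : Prop :=
  ¬ ∃ M : Cantor → ℕ → Cantor → ℝ, IsUniformMartingaleTest M ∧
    limsup (fun n => ((M β n α : ℝ) : EReal)) atTop = ⊤

/-! ### Martingales on bit arrays, Doob randomness -/

/-- `ω_{<m} ⌢ ξ`: the first `m` rows of `ω` followed by the rows of `ξ`. -/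
def rowConcat (ω : BitArray) (m : ℕ) (ξ : BitArray) : BitArray :=
  fun p => if p.1 < m then ω p else ξ (p.1 - m, p.2)

/-- The conditional expectation `𝔼ₘ f` on bit arrays, given the first `m` rows. -/
noncomputable def rowCondExp (m : ℕ) (f : BitArray → ℝ) (ω : BitArray) : ℝ :=
  ∫ ξ, f (rowConcat ω m ξ) ∂(uniformMeasure (ℕ × ℕ))

/-- Martingales on bit arrays; at time `n` the first `n` rows are known. -/
structure IsRowMartingale (M : ℕ → BitArray → ℝ) : Prop where
  integrable : ∀ n, Integrable (M n) (uniformMeasure (ℕ × ℕ))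
  adapted : ∀ n, ∃ g : BitArray → ℝ,
    DependsOn g {p : ℕ × ℕ | p.1 < n} ∧ M n =ᵐ[uniformMeasure (ℕ × ℕ)] g
  condExp_eq : ∀ m n, m ≤ n → rowCondExp m (M n) =ᵐ[uniformMeasure (ℕ × ℕ)] M m

/-- The bit sequence `⨁ₘ ωₘ`, with bit `ω (m, n)` at the position `⟨m, n⟩`. -/
def join (ω : BitArray) : Cantor := fun j => ω j.unpair

/-- `M n ω` is computable uniformly from `n` and `ω`. -/
def IsComputableRowSeq (M : ℕ → BitArray → ℝ) : Prop :=
  ∃ F : Cantor → ℕ × ℕ → ℕ, IsComputableFunctional F ∧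
    ∀ n ω, IsCauchyName (fun k => F (join ω) (n, k)) (M n ω)

/-- `ω` is Doob random. -/
def IsDoobRandom (ω : BitArray) : Prop :=
  ∀ M : ℕ → BitArray → ℝ, IsRowMartingale M → IsComputableRowSeq M → (∀ n ξ, 0 ≤ M n ξ) →
    ∃ a : ℝ, Tendsto (fun n => M n ω) atTop (𝓝 a)

/-! ### Positions above and below a function, and their orderings -/

/-- The positions on or above the graph of `f`. -/
def posAbove (f : ℕ → ℕ) : Set (ℕ × ℕ) := {p | f p.1 ≤ p.2}

/-- The positions below the graph of `f`. -/
def posBelow (f : ℕ → ℕ) : Set (ℕ × ℕ) := {p | p.2 < f p.1}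

/-- `e` is a computable ordering `e 0, e 1, …` of the infinite set `C`, without repetitions. -/
structure IsComputableOrdering (C : Set (ℕ × ℕ)) (e : ℕ → ℕ × ℕ) : Prop where
  computable : Computable e
  injective : Function.Injective e
  range_eq : Set.range e = C

/-- The bits of `ω` at the positions `e 0, e 1, …`. -/
def bitsAlong (e : ℕ → ℕ × ℕ) (ω : BitArray) : Cantor := fun n => ω (e n)

end DoobRand

open DoobRand

/-!
All computations take place on Cantor space; a bit array `ω` is read as the sequence `join ω`. By
compactness, a total computable functional on Cantor space is a truth-table functional: it reads a
number of bits bounded computably in its discrete argument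
(`IsComputableFunctional.isTruthTable`). Hence tests and martingales may be approximated by rational
functions of finitely many bits, whose conditional expectations, given the bits at any decidable
set of positions, are finite averages and again exactly computable (`cast_condAvg`).

Let `stage A inv n` consist of the positions above `f` together with the first `n` positions below
`f`, in a given ordering, and let `rowsBelow n` consist of the positions in the first `n` rows. A
uniform martingale test is essentially a martingale for the filtration `stage A inv`, and a row
martingale is one for `rowsBelow`. Both implications of the characterization, and the independence
of the orderings, are instances of one transfer between filtrations, `exists_exactMartingale`. Let
`q` be an approximate martingale for a filtration `J` that does not converge at `ω`, and let each
`K n` be contained in some `J (l n)` with `l` computable. Then there is an exact computable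
martingale for `K` that tends to infinity at `ω`. For the proof one trades along `q`, either
holding a fraction of a share that shrinks as the price grows, or buying below `a` and selling
above `b`. The resulting capital `T` is unbounded at `ω` and, on every sequence, loses at most a
constant from any time on. The new martingale is the conditional expectation of `T (l n)` given
`K n`. Since losses are bounded, it is large at `ω` as soon as `K n` determines that `T` has been
large once.

For a row martingale the function `f` is chosen such that the `n`th row on or above the graph of `f`
has no influence on the approximation at time `n + 1`; the approximation is then also a martingale
for the filtration by rows enlarged by all the positions above `f`
(`IsRowMartingale.exists_isApproxMartingale`), and this one is comparable with `stage A inv`.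
-/

namespace DoobRand

/-! ### Computable functions on discrete data -/

section Discrete

variable {α σ : Type} [Primcodable α] [Primcodable σ]

theorem computable_nat_add : Computable₂ ((· + ·) : ℕ → ℕ → ℕ) := Primrec.nat_add.to_comp
theorem computable_nat_sub : Computable₂ ((· - ·) : ℕ → ℕ → ℕ) := Primrec.nat_sub.to_comp
theorem computable_nat_mul : Computable₂ ((· * ·) : ℕ → ℕ → ℕ) := Primrec.nat_mul.to_comp
theorem computable_nat_div : Computable₂ ((· / ·) : ℕ → ℕ → ℕ) := Primrec.nat_div.to_comp
theorem computable_nat_mod : Computable₂ ((· % ·) : ℕ → ℕ → ℕ) := Primrec.nat_mod.to_comp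
theorem computable_nat_max : Computable₂ (max : ℕ → ℕ → ℕ) := Primrec.nat_max.to_comp
theorem computable_nat_pair : Computable₂ Nat.pair := Primrec₂.natPair.to_comp

theorem computable_nat_lt : Computable₂ fun a b : ℕ => decide (a < b) :=
  (Primrec.nat_lt.decide : Primrec₂ fun a b : ℕ => decide (a < b)).to_comp

theorem computable_nat_eq : Computable₂ fun a b : ℕ => decide (a = b) :=
  (Primrec.eq.decide : Primrec₂ fun a b : ℕ => decide (a = b)).to_comp

theorem computable_bool_or : Computable₂ or := Primrec.or.to_comp

theorem computable_bool_and : Computable₂ and := Primrec.and.to_comp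

theorem computable_ite {c : α → Prop} [DecidablePred c] {f g : α → σ}
    (hc : Computable fun a => decide (c a)) (hf : Computable f) (hg : Computable g) :
    Computable fun a => if c a then f a else g a :=
  (Computable.cond hc hf hg).of_eq fun a => by by_cases h : c a <;> simp [h]

/-- Iteration along `ℕ` with a parameter. -/
theorem computable_natRec {s₀ : α → σ} {h : (α × ℕ) × σ → σ} (h₀ : Computable s₀)
    (hh : Computable h) :
    Computable fun p : α × ℕ =>
      Nat.rec (motive := fun _ => σ) (s₀ p.1) (fun i s => h ((p.1, i), s)) p.2 := by
  refine Computable.nat_rec (h := fun (p : α × ℕ) (q : ℕ × σ) => h ((p.1, q.1), q.2))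
    Computable.snd (h₀.comp Computable.fst) ?_
  exact hh.comp (((Computable.fst.comp Computable.fst).pair
    (Computable.fst.comp Computable.snd)).pair (Computable.snd.comp Computable.snd))

theorem computable_sup {g : α × ℕ → ℕ} (hg : Computable g) :
    Computable fun p : α × ℕ => (Finset.range p.2).sup fun i => g (p.1, i) := by
  refine (computable_natRec (s₀ := fun _ : α => 0) (h := fun q => max (g q.1) q.2)
    (Computable.const 0) (computable_nat_max.comp (hg.comp Computable.fst)
      Computable.snd)).of_eq ?_
  rintro ⟨a, n⟩
  dsimp only
  induction n with
  | zero => rfl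
  | succ n ih => rw [Finset.range_add_one, Finset.sup_insert, ← ih]

theorem computable_forall_lt {p : α × ℕ → Bool} (hp : Computable p) :
    Computable fun q : α × ℕ => decide (∀ i < q.2, p (q.1, i) = true) := by
  refine (computable_natRec (s₀ := fun _ : α => true) (h := fun q => q.2 && p q.1)
    (Computable.const true) (computable_bool_and.comp Computable.snd
      (hp.comp Computable.fst))).of_eq ?_
  rintro ⟨a, n⟩
  dsimp only
  induction n with
  | zero => simp
  | succ n ih =>
    dsimp only
    rw [ih, Bool.eq_iff_iff]
    simp only [Bool.and_eq_true, decide_eq_true_eq, Nat.forall_lt_succ_right]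

theorem computable_pow_two : Computable fun n : ℕ => 2 ^ n := by
  refine ((computable_natRec (α := Unit) (s₀ := fun _ => 1) (h := fun q => 2 * q.2)
    (Computable.const 1) (computable_nat_mul.comp (Computable.const 2)
      Computable.snd)).comp ((Computable.const ()).pair Computable.id)).of_eq ?_
  intro n
  dsimp only [id]
  induction n with
  | zero => rfl
  | succ n ih => rw [pow_succ, ← ih, mul_comm]

theorem computable_testBit : Computable₂ Nat.testBit := by
  have h : Computable fun p : ℕ × ℕ => decide (p.1 / 2 ^ p.2 % 2 = 1) :=
    computable_nat_eq.comp (computable_nat_mod.comp (computable_nat_div.comp Computable.fst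
      (computable_pow_two.comp Computable.snd)) (Computable.const 2)) (Computable.const 1)
  refine h.of_eq ?_
  rintro ⟨v, i⟩
  simp [Nat.testBit_eq_decide_div_mod_eq]

theorem computable_initSeg {b : α → Cantor} (hb : Computable fun p : α × ℕ => b p.1 p.2) :
    Computable fun p : α × ℕ => initSeg (b p.1) p.2 := by
  refine (computable_natRec (s₀ := fun _ : α => ([] : List Bool))
    (h := fun q => q.2 ++ [b q.1.1 q.1.2]) (Computable.const [])
    (Computable.list_concat.comp Computable.snd (hb.comp Computable.fst))).of_eq ?_
  rintro ⟨a, n⟩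
  dsimp only
  induction n with
  | zero => rfl
  | succ n ih =>
    dsimp only
    rw [ih]
    simp [initSeg, List.range_succ]

/-- A total search. -/
theorem computable_find {p : α → ℕ → Bool} (hp : Computable₂ p) (h : ∀ a, ∃ n, p a n = true)
    {f : α → ℕ} (hf : ∀ a, f a = Nat.find (h a)) : Computable f := by
  refine Partrec.of_eq_tot (f := fun a => Nat.rfind (p a : ℕ → Bool))
    (Partrec.rfind hp.partrec₂) fun a => ?_
  rw [Nat.mem_rfind, hf]
  refine ⟨by simpa using (Nat.find_spec (h a)).symm, fun {m} hm => ?_⟩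
  have := Nat.find_min (h a) hm
  simpa using this

end Discrete

/-! ### Initial segments -/

@[simp] theorem length_initSeg (γ : Cantor) (s : ℕ) : (initSeg γ s).length = s := by
  simp [initSeg]

theorem initSeg_congr {γ δ : Cantor} {s : ℕ} (h : ∀ i < s, γ i = δ i) :
    initSeg γ s = initSeg δ s := by
  apply List.map_congr_left
  intro i hi
  exact h i (List.mem_range.1 hi)

theorem getD_initSeg (γ : Cantor) {s i : ℕ} (h : i < s) : (initSeg γ s).getD i false = γ i := by
  simp [initSeg, List.getD, h]

/-- The bits of a natural number, as an infinite sequence that is eventually `false`. -/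
def natBits (v : ℕ) : Cantor := fun i => v.testBit i

theorem exists_natBits (γ : Cantor) (s : ℕ) : ∃ v < 2 ^ s, ∀ i < s, natBits v i = γ i := by
  induction s with
  | zero => exact ⟨0, by simp⟩
  | succ s ih =>
    obtain ⟨v, hv, h⟩ := ih
    cases hb : γ s with
    | false =>
      refine ⟨v, by rw [pow_succ]; omega, fun i hi => ?_⟩
      rcases Nat.lt_succ_iff_lt_or_eq.1 hi with hi | rfl
      · exact h i hi
      · rw [hb]; exact Nat.testBit_lt_two_pow hv
    | true =>
      refine ⟨2 ^ s + v, by rw [pow_succ]; omega, fun i hi => ?_⟩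
      rcases Nat.lt_succ_iff_lt_or_eq.1 hi with hi | rfl
      · rw [← h i hi]; exact Nat.testBit_two_pow_add_gt hi v
      · rw [hb, natBits, Nat.testBit_two_pow_add_eq, Nat.testBit_lt_two_pow hv]; rfl

theorem exists_initSeg_natBits (γ : Cantor) (s : ℕ) :
    ∃ v < 2 ^ s, initSeg (natBits v) s = initSeg γ s :=
  let ⟨v, hv, h⟩ := exists_natBits γ s
  ⟨v, hv, initSeg_congr h⟩

theorem computable_initSeg_natBits : Computable fun p : ℕ × ℕ => initSeg (natBits p.1) p.2 :=
  computable_initSeg computable_testBit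

/-! ### Truth-table functionals -/

/-- The first value among `o 0, …, o (n - 1)` that is not `none`. -/
def firstSome {σ : Type} (o : ℕ → Option σ) : ℕ → Option σ
  | 0 => none
  | n + 1 => (firstSome o n).or (o n)

theorem exists_of_firstSome_eq_some {σ : Type} {o : ℕ → Option σ} {n : ℕ} {y : σ}
    (h : firstSome o n = some y) : ∃ i < n, o i = some y := by
  induction n with
  | zero => simp [firstSome] at h
  | succ n ih =>
    rcases Option.or_eq_some_iff.1 h with h | ⟨-, h⟩
    · obtain ⟨i, hi, e⟩ := ih h
      exact ⟨i, by omega, e⟩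
    · exact ⟨n, by omega, h⟩

theorem isSome_firstSome {σ : Type} {o : ℕ → Option σ} {n : ℕ} :
    (firstSome o n).isSome ↔ ∃ i < n, (o i).isSome := by
  induction n with
  | zero => simp [firstSome]
  | succ n ih =>
    rw [firstSome, Option.isSome_or, Bool.or_eq_true, ih]
    simp only [Nat.lt_succ_iff_lt_or_eq, or_and_right, exists_or, exists_eq_left]

section Answers

variable {τ σ : Type}

/-- The answer of `φ` on the shortest prefix of a string where there is one. -/
def persistentAnswer (φ : List Bool × τ → Option σ) (p : List Bool × τ) : Option σ :=
  firstSome (fun i => φ (initSeg (fun j => p.1.getD j false) i, p.2)) (p.1.length + 1)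

theorem prefix_initSeg (γ : Cantor) {s i : ℕ} (hi : i < s + 1) :
    initSeg (fun j => (initSeg γ s).getD j false) i = initSeg γ i :=
  initSeg_congr fun j hj => getD_initSeg γ (by omega)

theorem exists_of_persistentAnswer_eq_some {φ : List Bool × τ → Option σ} {γ : Cantor} {x : τ}
    {s : ℕ} {y : σ} (h : persistentAnswer φ (initSeg γ s, x) = some y) :
    ∃ i, φ (initSeg γ i, x) = some y := by
  obtain ⟨i, hi, e⟩ := exists_of_firstSome_eq_some h
  rw [length_initSeg] at hi
  rw [prefix_initSeg γ hi] at e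
  exact ⟨i, e⟩

theorem isSome_persistentAnswer {φ : List Bool × τ → Option σ} {γ : Cantor} {x : τ} {s : ℕ} :
    (persistentAnswer φ (initSeg γ s, x)).isSome ↔ ∃ i < s + 1, (φ (initSeg γ i, x)).isSome := by
  rw [persistentAnswer, isSome_firstSome]
  simp only [length_initSeg]
  refine exists_congr fun i => and_congr_right fun hi => ?_
  rw [prefix_initSeg γ hi]

/-- Whether `φ` answers on all the strings of a given length. -/
def answersAll (φ : List Bool × τ → Option σ) (p : τ × ℕ) : Bool :=
  decide (∀ v < 2 ^ p.2, (φ (initSeg (natBits v) p.2, p.1)).isSome = true)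

theorem answersAll_iff {φ : List Bool × τ → Option σ} {x : τ} {n : ℕ} :
    answersAll φ (x, n) = true ↔ ∀ γ, (φ (initSeg γ n, x)).isSome := by
  rw [answersAll, decide_eq_true_eq]
  refine ⟨fun h γ => ?_, fun h v _ => h (natBits v)⟩
  obtain ⟨v, hv, e⟩ := exists_initSeg_natBits γ n
  exact e ▸ h v hv

end Answers

section TruthTable

variable {τ ρ σ κ : Type} [Primcodable τ] [Primcodable ρ] [Primcodable σ] [Primcodable κ]

/-- `F γ x` is computed by a total algorithm from any initial segment of `γ` whose length is at
least a bound computable from `x` alone. -/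
def IsTruthTable (F : Cantor → τ → σ) : Prop :=
  ∃ (u : τ → ℕ) (ψ : List Bool × τ → σ), Computable u ∧ Computable ψ ∧
    ∀ γ x s, u x ≤ s → ψ (initSeg γ s, x) = F γ x

theorem IsTruthTable.isComputableFunctional {F : Cantor → τ → σ} (hF : IsTruthTable F) :
    IsComputableFunctional F := by
  obtain ⟨u, ψ, hu, hψ, h⟩ := hF
  refine ⟨fun p => bif decide (p.1.length < u p.2) then none else some (ψ p), ?_, ?_⟩
  · exact Computable.cond (computable_nat_lt.comp (Computable.list_length.comp Computable.fst)
      (hu.comp Computable.snd)) (Computable.const none) (Computable.option_some.comp hψ)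
  · refine fun γ x => ⟨⟨u x, by simp [h γ x (u x) le_rfl]⟩, fun s y hy => ?_⟩
    by_cases hs : s < u x
    · simp [hs] at hy
    · simp only [length_initSeg, hs, decide_false, cond_false, Option.some.injEq] at hy
      rw [← hy, h γ x s (not_lt.1 hs)]

theorem IsTruthTable.dependsOn {F : Cantor → τ → σ} (hF : IsTruthTable F) :
    ∃ u : τ → ℕ, Computable u ∧ ∀ x, DependsOn (fun γ => F γ x) (Set.Iio (u x)) := by
  obtain ⟨u, ψ, hu, -, h⟩ := hF
  refine ⟨u, hu, fun x γ δ hγδ => ?_⟩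
  dsimp only
  rw [← h γ x _ le_rfl, ← h δ x _ le_rfl, initSeg_congr fun i hi => hγδ i hi]

theorem isOpen_initSeg (P : List Bool → Prop) (s : ℕ) : IsOpen {γ : Cantor | P (initSeg γ s)} := by
  have : {γ : Cantor | P (initSeg γ s)} =
      (fun (γ : Cantor) (i : Fin s) => γ i) ⁻¹' {b | P (List.ofFn b)} := by
    ext γ
    have : initSeg γ s = List.ofFn fun i : Fin s => γ i := by
      apply List.ext_getElem <;> simp [initSeg]
    simp [this]
  rw [this]
  exact (isOpen_discrete _).preimage (by fun_prop)

theorem computable_firstSome {o : τ → ℕ → Option σ}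
    (ho : Computable fun p : τ × ℕ => o p.1 p.2) :
    Computable fun p : τ × ℕ => firstSome (o p.1) p.2 := by
  have hor : Computable fun q : (τ × ℕ) × Option σ => q.2.or (o q.1.1 q.1.2) :=
    (Computable.option_casesOn Computable.snd (ho.comp Computable.fst)
      (Computable.option_some.comp Computable.snd).to₂).of_eq fun q => by
        rcases q with ⟨q, _ | _⟩ <;> rfl
  refine (computable_natRec (s₀ := fun _ : τ => (none : Option σ)) (Computable.const none)
    hor).of_eq ?_
  rintro ⟨x, n⟩
  dsimp only
  induction n with
  | zero => rfl
  | succ n ih =>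
    dsimp only
    rw [ih, firstSome]

theorem computable_persistentAnswer {φ : List Bool × τ → Option σ} (hφ : Computable φ) :
    Computable (persistentAnswer φ) := by
  have hprefix : Computable fun q : (List Bool × τ) × ℕ =>
      initSeg (fun j => q.1.1.getD j false) q.2 :=
    computable_initSeg (b := fun (p : List Bool × τ) j => p.1.getD j false)
      ((Primrec.list_getD false).to_comp.comp (Computable.fst.comp Computable.fst)
        Computable.snd)
  have hanswer : Computable fun q : (List Bool × τ) × ℕ =>
      φ (initSeg (fun j => q.1.1.getD j false) q.2, q.1.2) :=
    hφ.comp (hprefix.pair (Computable.snd.comp Computable.fst))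
  have hlen : Computable fun p : List Bool × τ => (p, p.1.length + 1) :=
    Computable.id.pair (Computable.succ.comp (Computable.list_length.comp Computable.fst))
  have hfirst := computable_firstSome
    (o := fun (p : List Bool × τ) i => φ (initSeg (fun j => p.1.getD j false) i, p.2)) hanswer
  exact (hfirst.comp hlen).of_eq fun _ => rfl

theorem computable_answersAll {φ : List Bool × τ → Option σ} (hφ : Computable φ) :
    Computable (answersAll φ) := by
  have h1 : Computable fun q : (τ × ℕ) × ℕ => (initSeg (natBits q.2) q.1.2, q.1.1) :=
    (computable_initSeg_natBits.comp (Computable.snd.pair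
      (Computable.snd.comp Computable.fst))).pair (Computable.fst.comp Computable.fst)
  have h2 : Computable fun q : (τ × ℕ) × ℕ =>
      (φ (initSeg (natBits q.2) q.1.2, q.1.1)).isSome :=
    Primrec.option_isSome.to_comp.comp (hφ.comp h1)
  have h3 : Computable fun p : τ × ℕ => (p, 2 ^ p.2) :=
    Computable.id.pair (computable_pow_two.comp Computable.snd)
  exact ((computable_forall_lt h2).comp h3).of_eq fun _ => rfl

/-- On Cantor space every total computable functional is a truth-table functional: by compactness
there is a length at which the computation has halted on all strings, and it is found by search. -/
theorem IsComputableFunctional.isTruthTable [Inhabited σ] {F : Cantor → τ → σ}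
    (hF : IsComputableFunctional F) : IsTruthTable F := by
  obtain ⟨φ, hφ, h⟩ := hF
  have hmono : ∀ γ x s t, s ≤ t → (persistentAnswer φ (initSeg γ s, x)).isSome →
      (persistentAnswer φ (initSeg γ t, x)).isSome := fun γ x s t hst hs =>
    let ⟨i, hi, e⟩ := isSome_persistentAnswer.1 hs
    isSome_persistentAnswer.2 ⟨i, by omega, e⟩
  have hex : ∀ x, ∃ n, answersAll (persistentAnswer φ) (x, n) = true := by
    intro x
    obtain ⟨n, hn⟩ := isCompact_univ.elim_directed_cover
      (fun n => {γ | (persistentAnswer φ (initSeg γ n, x)).isSome})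
      (isOpen_initSeg fun l => (persistentAnswer φ (l, x)).isSome)
      (fun γ _ => by
        obtain ⟨s, hs⟩ := (h γ x).1
        exact Set.mem_iUnion.2 ⟨s, isSome_persistentAnswer.2 ⟨s, by omega, by simp [hs]⟩⟩)
      (directed_of_isDirected_le fun a b hab γ hγ => hmono γ x a b hab hγ)
    exact ⟨n, answersAll_iff.2 fun γ => hn (Set.mem_univ γ)⟩
  have hall : Computable₂ fun (x : τ) (n : ℕ) => answersAll (persistentAnswer φ) (x, n) :=
    computable_answersAll (computable_persistentAnswer hφ)
  refine ⟨fun x => Nat.find (hex x), fun p => (persistentAnswer φ p).getD default,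
    computable_find hall hex fun _ => rfl,
    Computable.option_getD (computable_persistentAnswer hφ) (Computable.const _),
    fun γ x s hs => ?_⟩
  have hb := answersAll_iff.1 (Nat.find_spec (hex x)) γ
  obtain ⟨y, hy⟩ := Option.isSome_iff_exists.1 (hmono γ x _ s hs hb)
  obtain ⟨i, e⟩ := exists_of_persistentAnswer_eq_some hy
  dsimp only
  rw [hy, Option.getD_some]
  exact (h γ x).2 i y e

theorem isTruthTable_of_computable {f : τ → σ} (hf : Computable f) :
    IsTruthTable fun (_ : Cantor) x => f x :=
  ⟨fun _ => 0, fun p => f p.2, Computable.const 0, hf.comp Computable.snd, fun _ _ _ _ => rfl⟩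

theorem isTruthTable_eval : IsTruthTable fun (γ : Cantor) (n : ℕ) => γ n :=
  ⟨fun n => n + 1, fun p => p.1.getD p.2 false, Computable.succ,
    (Primrec.list_getD false).to_comp, fun γ _ _ h => getD_initSeg γ h⟩

theorem IsTruthTable.pair {F : Cantor → τ → σ} {G : Cantor → τ → ρ} (hF : IsTruthTable F)
    (hG : IsTruthTable G) : IsTruthTable fun γ x => (F γ x, G γ x) := by
  obtain ⟨u, ψ, hu, hψ, h⟩ := hF
  obtain ⟨u', ψ', hu', hψ', h'⟩ := hG
  refine ⟨fun x => max (u x) (u' x), fun p => (ψ p, ψ' p), computable_nat_max.comp hu hu',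
    hψ.pair hψ', fun γ x s hs => ?_⟩
  dsimp only
  rw [h γ x s (le_trans (le_max_left _ _) hs), h' γ x s (le_trans (le_max_right _ _) hs)]

theorem IsTruthTable.comp {F : Cantor → ρ → σ} {G : Cantor → τ → ρ} (hF : IsTruthTable F)
    (hG : IsTruthTable G) : IsTruthTable fun γ x => F γ (G γ x) := by
  obtain ⟨u, ψ, hu, hψ, h⟩ := hF
  obtain ⟨u', ψ', hu', hψ', h'⟩ := hG
  -- all the possible values of `G · x` are obtained from the strings of length `u' x`
  refine ⟨fun x => max (u' x) ((Finset.range (2 ^ u' x)).sup fun v =>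
    u (ψ' (initSeg (natBits v) (u' x), x))), fun p => ψ (p.1, ψ' p), ?_, ?_, fun γ x s hs => ?_⟩
  · refine computable_nat_max.comp hu' ?_
    refine (computable_sup (α := τ) (g := fun q => u (ψ' (initSeg (natBits q.2) (u' q.1), q.1)))
      ?_).comp (Computable.id.pair (computable_pow_two.comp hu'))
    exact hu.comp (hψ'.comp ((computable_initSeg_natBits.comp
      (Computable.snd.pair (hu'.comp Computable.fst))).pair Computable.fst))
  · exact hψ.comp (Computable.fst.pair hψ')
  · dsimp only
    rw [h' γ x s (le_trans (le_max_left _ _) hs)]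
    refine h γ _ s (le_trans ?_ (le_trans (le_max_right _ _) hs))
    obtain ⟨v, hv, e⟩ := exists_initSeg_natBits γ (u' x)
    have := Finset.le_sup (f := fun v => u (ψ' (initSeg (natBits v) (u' x), x)))
      (Finset.mem_range.2 hv)
    rwa [e, h' γ x _ le_rfl] at this

theorem IsTruthTable.comp_computable {F : Cantor → ρ → σ} {f : τ → ρ} (hF : IsTruthTable F)
    (hf : Computable f) : IsTruthTable fun γ x => F γ (f x) :=
  hF.comp (isTruthTable_of_computable hf)

theorem isTruthTable_comp {f : ρ → σ} {G : Cantor → τ → ρ} (hf : Computable f)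
    (hG : IsTruthTable G) : IsTruthTable fun γ x => f (G γ x) :=
  (isTruthTable_of_computable hf).comp hG

theorem isTruthTable_comp₂ {f : ρ → κ → σ} {G : Cantor → τ → ρ} {H : Cantor → τ → κ}
    (hf : Computable₂ f) (hG : IsTruthTable G) (hH : IsTruthTable H) :
    IsTruthTable fun γ x => f (G γ x) (H γ x) :=
  isTruthTable_comp (f := fun p : ρ × κ => f p.1 p.2) hf (hG.pair hH)

/-- The oracle may itself be computed, by a truth-table functional, from another oracle. -/
theorem IsTruthTable.subst {F : Cantor → τ → σ} {G : Cantor → τ × ℕ → Bool} (hF : IsTruthTable F)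
    (hG : IsTruthTable G) : IsTruthTable fun γ x => F (fun i => G γ (x, i)) x := by
  obtain ⟨u, ψ, hu, hψ, h⟩ := hF
  obtain ⟨u', ψ', hu', hψ', h'⟩ := hG
  refine ⟨fun x => (Finset.range (u x)).sup fun i => u' (x, i),
    fun p => ψ (initSeg (fun i => ψ' (p.1, (p.2, i))) (u p.2), p.2), ?_, ?_, fun γ x s hs => ?_⟩
  · exact (computable_sup hu').comp (Computable.id.pair hu)
  · refine hψ.comp (Computable.pair ?_ Computable.snd)
    refine (computable_initSeg (b := fun (p : List Bool × τ) i => ψ' (p.1, (p.2, i))) ?_).comp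
      (Computable.id.pair (hu.comp Computable.snd))
    exact hψ'.comp ((Computable.fst.comp Computable.fst).pair
      ((Computable.snd.comp Computable.fst).pair Computable.snd))
  · dsimp only
    rw [← h (fun i => G γ (x, i)) x (u x) le_rfl]
    refine congrArg (fun l => ψ (l, x)) (initSeg_congr fun i hi => h' γ (x, i) s (le_trans ?_ hs))
    exact Finset.le_sup (f := fun i => u' (x, i)) (Finset.mem_range.2 hi)

theorem IsTruthTable.natRec {s₀ : σ} {h : σ × ρ → σ} {Q : Cantor → τ × ℕ → ρ} (hh : Computable h)
    (hQ : IsTruthTable Q) :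
    IsTruthTable fun γ (p : τ × ℕ) =>
      Nat.rec (motive := fun _ => σ) s₀ (fun i s => h (s, Q γ (p.1, i))) p.2 := by
  obtain ⟨u, ψ, hu, hψ, e⟩ := hQ
  refine ⟨fun p => (Finset.range p.2).sup fun i => u (p.1, i), fun q =>
    Nat.rec (motive := fun _ => σ) s₀ (fun i s => h (s, ψ (q.1, (q.2.1, i)))) q.2.2,
    computable_sup hu, ?_, ?_⟩
  · refine (computable_natRec (α := List Bool × τ) (s₀ := fun _ => s₀)
      (h := fun r => h (r.2, ψ (r.1.1.1, (r.1.1.2, r.1.2)))) (Computable.const s₀) ?_).comp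
      ((Computable.fst.pair (Computable.fst.comp Computable.snd)).pair
        (Computable.snd.comp Computable.snd))
    exact hh.comp (Computable.snd.pair (hψ.comp
      ((Computable.fst.comp (Computable.fst.comp Computable.fst)).pair
      ((Computable.snd.comp (Computable.fst.comp Computable.fst)).pair
        (Computable.snd.comp Computable.fst)))))
  · rintro γ ⟨x, n⟩ s hs
    dsimp only at hs ⊢
    have hs' : ∀ i < n, u (x, i) ≤ s := fun i hi =>
      le_trans (Finset.le_sup (f := fun i => u (x, i)) (Finset.mem_range.2 hi)) hs
    clear hs
    induction n with
    | zero => rfl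
    | succ n ih =>
      dsimp only
      rw [ih fun i hi => hs' i (by omega), e γ (x, n) s (hs' n (by omega))]

end TruthTable

/-! ### Computable rational-valued functionals -/

section Codes

/-- The code of `(a - b) / (c + 1)`. -/
def mkCode (a b c : ℕ) : ℕ := Nat.pair a (Nat.pair b c)

theorem ratOfCode_mkCode (a b c : ℕ) : ratOfCode (mkCode a b c) = ((a : ℚ) - b) / (c + 1) := by
  simp [ratOfCode, mkCode]

variable {τ : Type} [Primcodable τ]

theorem computable_mkCode {a b c : τ → ℕ} (ha : Computable a) (hb : Computable b)
    (hc : Computable c) : Computable fun x => mkCode (a x) (b x) (c x) :=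
  computable_nat_pair.comp ha (computable_nat_pair.comp hb hc)

/-- The first number in the triple coded by `i`. -/
def codePos (i : ℕ) : ℕ := i.unpair.1
/-- The second number in the triple coded by `i`. -/
def codeNeg (i : ℕ) : ℕ := i.unpair.2.unpair.1
/-- The third number in the triple coded by `i`. -/
def codeDen (i : ℕ) : ℕ := i.unpair.2.unpair.2

theorem computable_codePos : Computable codePos := Computable.fst.comp Computable.unpair

theorem computable_codeNeg : Computable codeNeg :=
  Computable.fst.comp (Computable.unpair.comp (Computable.snd.comp Computable.unpair))

theorem computable_codeDen : Computable codeDen :=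
  Computable.snd.comp (Computable.unpair.comp (Computable.snd.comp Computable.unpair))

theorem ratOfCode_eq (i : ℕ) : ratOfCode i = ((codePos i : ℚ) - codeNeg i) / (codeDen i + 1) := rfl

/-- Addition on codes of rationals. -/
def addCode (i j : ℕ) : ℕ :=
  mkCode (codePos i * (codeDen j + 1) + codePos j * (codeDen i + 1))
    (codeNeg i * (codeDen j + 1) + codeNeg j * (codeDen i + 1))
    (codeDen i * codeDen j + codeDen i + codeDen j)

theorem ratOfCode_addCode (i j : ℕ) : ratOfCode (addCode i j) = ratOfCode i + ratOfCode j := by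
  rw [addCode, ratOfCode_mkCode, ratOfCode_eq, ratOfCode_eq]
  push_cast
  have h1 : (codeDen i : ℚ) + 1 ≠ 0 := by positivity
  have h2 : (codeDen j : ℚ) + 1 ≠ 0 := by positivity
  have h3 : (codeDen i : ℚ) * codeDen j + codeDen i + codeDen j + 1 =
    (codeDen i + 1) * (codeDen j + 1) := by ring
  rw [h3]
  field_simp
  ring

theorem computable_addCode : Computable₂ addCode := by
  have p1 : Computable fun p : ℕ × ℕ => codePos p.1 := computable_codePos.comp Computable.fst
  have p2 : Computable fun p : ℕ × ℕ => codePos p.2 := computable_codePos.comp Computable.snd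
  have n1 : Computable fun p : ℕ × ℕ => codeNeg p.1 := computable_codeNeg.comp Computable.fst
  have n2 : Computable fun p : ℕ × ℕ => codeNeg p.2 := computable_codeNeg.comp Computable.snd
  have d1 : Computable fun p : ℕ × ℕ => codeDen p.1 := computable_codeDen.comp Computable.fst
  have d2 : Computable fun p : ℕ × ℕ => codeDen p.2 := computable_codeDen.comp Computable.snd
  have e1 := Computable.succ.comp d1
  have e2 := Computable.succ.comp d2
  exact computable_mkCode
    (computable_nat_add.comp (computable_nat_mul.comp p1 e2) (computable_nat_mul.comp p2 e1))
    (computable_nat_add.comp (computable_nat_mul.comp n1 e2) (computable_nat_mul.comp n2 e1))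
    (computable_nat_add.comp (computable_nat_add.comp (computable_nat_mul.comp d1 d2) d1) d2)

/-- Multiplication on codes of rationals. -/
def mulCode (i j : ℕ) : ℕ :=
  mkCode (codePos i * codePos j + codeNeg i * codeNeg j)
    (codePos i * codeNeg j + codeNeg i * codePos j)
    (codeDen i * codeDen j + codeDen i + codeDen j)

theorem ratOfCode_mulCode (i j : ℕ) : ratOfCode (mulCode i j) = ratOfCode i * ratOfCode j := by
  rw [mulCode, ratOfCode_mkCode, ratOfCode_eq, ratOfCode_eq]
  push_cast
  have h1 : (codeDen i : ℚ) + 1 ≠ 0 := by positivity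
  have h2 : (codeDen j : ℚ) + 1 ≠ 0 := by positivity
  have h3 : (codeDen i : ℚ) * codeDen j + codeDen i + codeDen j + 1 =
    (codeDen i + 1) * (codeDen j + 1) := by ring
  rw [h3]
  field_simp
  ring

theorem computable_mulCode : Computable₂ mulCode := by
  have p1 : Computable fun p : ℕ × ℕ => codePos p.1 := computable_codePos.comp Computable.fst
  have p2 : Computable fun p : ℕ × ℕ => codePos p.2 := computable_codePos.comp Computable.snd
  have n1 : Computable fun p : ℕ × ℕ => codeNeg p.1 := computable_codeNeg.comp Computable.fst
  have n2 : Computable fun p : ℕ × ℕ => codeNeg p.2 := computable_codeNeg.comp Computable.snd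
  have d1 : Computable fun p : ℕ × ℕ => codeDen p.1 := computable_codeDen.comp Computable.fst
  have d2 : Computable fun p : ℕ × ℕ => codeDen p.2 := computable_codeDen.comp Computable.snd
  exact computable_mkCode
    (computable_nat_add.comp (computable_nat_mul.comp p1 p2) (computable_nat_mul.comp n1 n2))
    (computable_nat_add.comp (computable_nat_mul.comp p1 n2) (computable_nat_mul.comp n1 p2))
    (computable_nat_add.comp (computable_nat_add.comp (computable_nat_mul.comp d1 d2) d1) d2)

/-- The code of the positive part of a coded rational. -/
def posCode (i : ℕ) : ℕ := mkCode (codePos i - codeNeg i) 0 (codeDen i)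

theorem ratOfCode_posCode (i : ℕ) : ratOfCode (posCode i) = max (ratOfCode i) 0 := by
  rw [posCode, ratOfCode_mkCode, ratOfCode_eq]
  have h1 : (0 : ℚ) < (codeDen i : ℚ) + 1 := by positivity
  rcases le_total (codeNeg i) (codePos i) with h | h
  · rw [Nat.cast_sub h, max_eq_left]
    · simp
    · have : (codeNeg i : ℚ) ≤ codePos i := by exact_mod_cast h
      exact div_nonneg (by linarith) h1.le
  · rw [Nat.sub_eq_zero_of_le h, max_eq_right]
    · simp
    · have : (codePos i : ℚ) ≤ codeNeg i := by exact_mod_cast h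
      exact div_nonpos_of_nonpos_of_nonneg (by linarith) h1.le

theorem computable_posCode : Computable posCode :=
  computable_mkCode (computable_nat_sub.comp computable_codePos computable_codeNeg)
    (Computable.const 0) computable_codeDen

theorem computable_ratOfCode_lt :
    Computable₂ fun i j : ℕ => decide (ratOfCode i < ratOfCode j) := by
  have p1 : Computable fun p : ℕ × ℕ => codePos p.1 := computable_codePos.comp Computable.fst
  have p2 : Computable fun p : ℕ × ℕ => codePos p.2 := computable_codePos.comp Computable.snd
  have n1 : Computable fun p : ℕ × ℕ => codeNeg p.1 := computable_codeNeg.comp Computable.fst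
  have n2 : Computable fun p : ℕ × ℕ => codeNeg p.2 := computable_codeNeg.comp Computable.snd
  have e1 := Computable.succ.comp (computable_codeDen.comp (Computable.fst (α := ℕ) (β := ℕ)))
  have e2 := Computable.succ.comp (computable_codeDen.comp (Computable.snd (α := ℕ) (β := ℕ)))
  have h := computable_nat_lt.comp
    (computable_nat_add.comp (computable_nat_mul.comp p1 e2) (computable_nat_mul.comp n2 e1))
    (computable_nat_add.comp (computable_nat_mul.comp p2 e1) (computable_nat_mul.comp n1 e2))
  refine h.of_eq ?_
  rintro ⟨i, j⟩
  have h1 : (0 : ℚ) < (codeDen i : ℚ) + 1 := by positivity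
  have h2 : (0 : ℚ) < (codeDen j : ℚ) + 1 := by positivity
  refine decide_eq_decide.2 ?_
  rw [ratOfCode_eq, ratOfCode_eq, div_lt_div_iff₀ h1 h2, ← Nat.cast_lt (α := ℚ)]
  push_cast
  constructor <;> intro h <;> linarith

theorem computable_ceil_ratOfCode : Computable fun i : ℕ => ⌈ratOfCode i⌉₊ := by
  have h := computable_nat_div.comp
    (computable_nat_add.comp (computable_nat_sub.comp computable_codePos computable_codeNeg)
      computable_codeDen) (Computable.succ.comp computable_codeDen)
  refine h.of_eq fun i => eq_of_forall_ge_iff fun n => ?_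
  have h1 : (0 : ℚ) < (codeDen i : ℚ) + 1 := by positivity
  rw [Nat.ceil_le, ratOfCode_eq, div_le_iff₀ h1, Nat.succ_eq_add_one,
    Nat.div_le_iff_le_mul_add_pred (Nat.succ_pos _)]
  have : (codePos i : ℚ) - codeNeg i ≤ n * (codeDen i + 1) ↔
      codePos i ≤ n * (codeDen i + 1) + codeNeg i := by
    rw [← Nat.cast_le (α := ℚ)]
    push_cast
    constructor <;> intro h <;> linarith
  rw [this, mul_comm n, Nat.succ_eq_add_one]
  omega

end Codes

section RatTruthTable

variable {τ ρ : Type} [Primcodable τ] [Primcodable ρ]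

/-- A rational-valued functional whose values have truth-table computable codes. -/
def IsRatTruthTable (F : Cantor → τ → ℚ) : Prop :=
  ∃ c : Cantor → τ → ℕ, IsTruthTable c ∧ ∀ γ x, ratOfCode (c γ x) = F γ x

theorem IsTruthTable.ratOfCode {c : Cantor → τ → ℕ} (hc : IsTruthTable c) :
    IsRatTruthTable fun γ x => ratOfCode (c γ x) :=
  ⟨c, hc, fun _ _ => rfl⟩

theorem isRatTruthTable_of_computable {c : τ → ℕ} {f : τ → ℚ} (hc : Computable c)
    (h : ∀ x, DoobRand.ratOfCode (c x) = f x) : IsRatTruthTable fun (_ : Cantor) x => f x :=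
  ⟨fun _ => c, isTruthTable_of_computable hc, fun _ => h⟩

theorem isRatTruthTable_const (r : ℚ) : IsRatTruthTable fun (_ : Cantor) (_ : τ) => r := by
  obtain ⟨i, hi⟩ := ratOfCode_surjective r
  exact isRatTruthTable_of_computable (Computable.const i) fun _ => hi

theorem isRatTruthTable_inv_two_pow {u : τ → ℕ} (hu : Computable u) :
    IsRatTruthTable fun (_ : Cantor) x => ((2 : ℚ) ^ u x)⁻¹ := by
  refine isRatTruthTable_of_computable (c := fun x => mkCode 1 0 (2 ^ u x - 1))
    (computable_mkCode (Computable.const 1) (Computable.const 0)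
      (computable_nat_sub.comp (computable_pow_two.comp hu) (Computable.const 1))) fun x => ?_
  rw [ratOfCode_mkCode, Nat.cast_sub Nat.one_le_two_pow]
  simp

namespace IsRatTruthTable

variable {F G : Cantor → τ → ℚ}

theorem add (hF : IsRatTruthTable F) (hG : IsRatTruthTable G) :
    IsRatTruthTable fun γ x => F γ x + G γ x := by
  obtain ⟨c, hc, h⟩ := hF
  obtain ⟨d, hd, h'⟩ := hG
  exact ⟨fun γ x => addCode (c γ x) (d γ x), isTruthTable_comp₂ computable_addCode hc hd,
    fun γ x => by rw [ratOfCode_addCode, h, h']⟩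

theorem mul (hF : IsRatTruthTable F) (hG : IsRatTruthTable G) :
    IsRatTruthTable fun γ x => F γ x * G γ x := by
  obtain ⟨c, hc, h⟩ := hF
  obtain ⟨d, hd, h'⟩ := hG
  exact ⟨fun γ x => mulCode (c γ x) (d γ x), isTruthTable_comp₂ computable_mulCode hc hd,
    fun γ x => by rw [ratOfCode_mulCode, h, h']⟩

theorem sub (hF : IsRatTruthTable F) (hG : IsRatTruthTable G) :
    IsRatTruthTable fun γ x => F γ x - G γ x := by
  obtain ⟨c, hc, h⟩ := hF.add ((isRatTruthTable_const (-1)).mul hG)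
  exact ⟨c, hc, fun γ x => by rw [h]; ring⟩

theorem posPart (hF : IsRatTruthTable F) : IsRatTruthTable fun γ x => max (F γ x) 0 := by
  obtain ⟨c, hc, h⟩ := hF
  exact ⟨fun γ x => posCode (c γ x), isTruthTable_comp computable_posCode hc,
    fun γ x => by rw [ratOfCode_posCode, h]⟩

theorem comp_computable {F : Cantor → ρ → ℚ} (hF : IsRatTruthTable F) {f : τ → ρ}
    (hf : Computable f) : IsRatTruthTable fun γ x => F γ (f x) := by
  obtain ⟨c, hc, h⟩ := hF
  exact ⟨_, hc.comp_computable hf, fun γ x => h γ (f x)⟩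

theorem subst (hF : IsRatTruthTable F) {G : Cantor → τ × ℕ → Bool} (hG : IsTruthTable G) :
    IsRatTruthTable fun γ x => F (fun i => G γ (x, i)) x := by
  obtain ⟨c, hc, h⟩ := hF
  exact ⟨_, hc.subst hG, fun γ x => h _ x⟩

theorem sum {F : Cantor → τ × ℕ → ℚ} (hF : IsRatTruthTable F) :
    IsRatTruthTable fun γ (p : τ × ℕ) => ∑ i ∈ Finset.range p.2, F γ (p.1, i) := by
  obtain ⟨c, hc, h⟩ := hF
  refine ⟨_, IsTruthTable.natRec (s₀ := 0) (h := fun p : ℕ × ℕ => addCode p.1 p.2)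
    computable_addCode hc, ?_⟩
  rintro γ ⟨x, n⟩
  dsimp only
  induction n with
  | zero => simp [ratOfCode]
  | succ n ih =>
    dsimp only
    rw [ratOfCode_addCode, Finset.sum_range_succ, ← ih, h]

theorem dependsOn (hF : IsRatTruthTable F) :
    ∃ u : τ → ℕ, Computable u ∧ ∀ x, DependsOn (fun γ => F γ x) (Set.Iio (u x)) := by
  obtain ⟨c, hc, h⟩ := hF
  obtain ⟨u, hu, h'⟩ := hc.dependsOn
  refine ⟨u, hu, fun x γ δ hγδ => ?_⟩
  dsimp only
  rw [← h, ← h]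
  exact congrArg DoobRand.ratOfCode (h' x hγδ)

end IsRatTruthTable

/-- The sequence with the bits of `x` at the positions in `J` and those of `y` elsewhere. -/
def mix (J : ℕ → Bool) (x y : Cantor) : Cantor := fun p => bif J p then x p else y p

/-- The average of `g (mix J x y)` over all the choices of the first `u` bits of `y`. -/
def condAvg (u : ℕ) (J : ℕ → Bool) (g : Cantor → ℚ) (x : Cantor) : ℚ :=
  (∑ v ∈ Finset.range (2 ^ u), g (mix J x (natBits v))) * ((2 : ℚ) ^ u)⁻¹

theorem IsRatTruthTable.condAvg {F : Cantor → τ → ℚ} (hF : IsRatTruthTable F) {u : τ → ℕ}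
    (hu : Computable u) {J : τ → ℕ → Bool} (hJ : Computable₂ J) :
    IsRatTruthTable fun γ x => condAvg (u x) (J x) (fun δ => F δ x) γ := by
  have hG : IsTruthTable fun (γ : Cantor) (q : (τ × ℕ) × ℕ) =>
      mix (J q.1.1) γ (natBits q.1.2) q.2 := by
    have h1 : Computable fun q : (τ × ℕ) × ℕ => J q.1.1 q.2 :=
      hJ.comp (Computable.fst.comp Computable.fst) Computable.snd
    have h2 : Computable fun q : (τ × ℕ) × ℕ => natBits q.1.2 q.2 :=
      computable_testBit.comp (Computable.snd.comp Computable.fst) Computable.snd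
    have h3 : Computable fun r : Bool × Bool × Bool => bif r.1 then r.2.1 else r.2.2 :=
      Computable.cond Computable.fst (Computable.fst.comp Computable.snd)
        (Computable.snd.comp Computable.snd)
    exact isTruthTable_comp h3 ((isTruthTable_of_computable h1).pair
      ((isTruthTable_eval.comp_computable Computable.snd).pair (isTruthTable_of_computable h2)))
  have hsum := (IsRatTruthTable.sum ((hF.comp_computable
    (Computable.fst (α := τ) (β := ℕ))).subst hG)).comp_computable
    (Computable.id.pair (computable_pow_two.comp hu))
  exact hsum.mul (isRatTruthTable_inv_two_pow hu)

end RatTruthTable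

/-! ### The uniform measure -/

section Uniform

variable {ι κ : Type}

instance : IsProbabilityMeasure (uniformMeasure ι) := by
  unfold uniformMeasure
  infer_instance

theorem uniformMeasure_pi (s : Finset ι) (t : ι → Set Bool) :
    uniformMeasure ι (Set.pi s t) =
      ∏ i ∈ s, (PMF.uniformOfFintype Bool).toMeasure (t i) :=
  Measure.infinitePi_pi _ fun _ _ => MeasurableSet.of_discrete

theorem eq_uniformMeasure {ν : Measure (ι → Bool)}
    (h : ∀ (s : Finset ι) (t : ι → Set Bool),
      ν (Set.pi s t) = ∏ i ∈ s, (PMF.uniformOfFintype Bool).toMeasure (t i)) :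
    ν = uniformMeasure ι :=
  Measure.eq_infinitePi _ fun s t _ => h s t

theorem toMeasure_uniformOfFintype_bool_singleton (b : Bool) :
    (PMF.uniformOfFintype Bool).toMeasure {b} = 2⁻¹ := by
  rw [PMF.toMeasure_apply_singleton _ _ (measurableSet_singleton b)]
  simp

theorem measurePreserving_comp_injective {e : ι → κ} (he : Function.Injective e) :
    MeasurePreserving (fun y : κ → Bool => y ∘ e) (uniformMeasure κ) (uniformMeasure ι) := by
  classical
  have hm : Measurable fun y : κ → Bool => y ∘ e :=
    measurable_pi_lambda _ fun i => measurable_pi_apply (e i)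
  refine ⟨hm, eq_uniformMeasure fun s t => ?_⟩
  rw [Measure.map_apply hm (MeasurableSet.pi s.countable_toSet fun _ _ => .of_discrete)]
  have : (fun y : κ → Bool => y ∘ e) ⁻¹' Set.pi s t =
      Set.pi (s.map ⟨e, he⟩ : Finset κ) fun k => {b | ∀ i, e i = k → b ∈ t i} := by
    ext y
    simp only [Set.mem_preimage, Set.mem_pi, Finset.coe_map, Function.Embedding.coeFn_mk,
      Set.mem_image, Finset.mem_coe, Function.comp_apply, Set.mem_ofPred_eq,
      forall_exists_index, and_imp, forall_apply_eq_imp_iff₂]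
    exact ⟨fun h i hi j hj => by rw [he hj]; exact h i hi, fun h i hi => h i hi i rfl⟩
  rw [this, uniformMeasure_pi, Finset.prod_map]
  refine Finset.prod_congr rfl fun i _ => ?_
  congr 1
  ext b
  exact ⟨fun h => h i rfl, fun h j hj => by rw [he hj]; exact h⟩

instance : (uniformMeasure ι).IsOpenPosMeasure := by
  refine ⟨fun U hU ⟨x, hx⟩ => ?_⟩
  obtain ⟨s, t, ht, hsub⟩ := isOpen_pi_iff.1 hU x hx
  have hpos : 0 < uniformMeasure ι (Set.pi s t) := by
    rw [uniformMeasure_pi]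
    refine pos_iff_ne_zero.2 (Finset.prod_ne_zero_iff.2 fun i hi => ?_)
    have : (PMF.uniformOfFintype Bool).toMeasure {x i} ≤
        (PMF.uniformOfFintype Bool).toMeasure (t i) :=
      measure_mono (Set.singleton_subset_iff.2 (ht i hi).2)
    rw [toMeasure_uniformOfFintype_bool_singleton] at this
    intro h0
    rw [h0] at this
    simp at this
  exact (lt_of_lt_of_le hpos (measure_mono hsub)).ne'

end Uniform

theorem integral_comp_of_measurePreserving {α β : Type*}
    [MeasurableSpace α] [MeasurableSpace β] {μ : Measure α} {ν : Measure β} {f : α → β}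
    (hf : MeasurePreserving f μ ν) {g : β → ℝ} (hg : Measurable g) :
    ∫ x, g (f x) ∂μ = ∫ y, g y ∂ν := by
  rw [← hf.map_eq, integral_map hf.measurable.aemeasurable hg.aestronglyMeasurable]

/-! ### Mixing two sequences -/

theorem mix_of_true {J : ℕ → Bool} {p : ℕ} (h : J p = true) (x y : Cantor) :
    mix J x y p = x p := by simp [mix, h]

theorem mix_of_false {J : ℕ → Bool} {p : ℕ} (h : J p = false) (x y : Cantor) :
    mix J x y p = y p := by simp [mix, h]

theorem measurable_mix (J : ℕ → Bool) : Measurable fun p : Cantor × Cantor => mix J p.1 p.2 := by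
  refine measurable_pi_lambda _ fun i => ?_
  cases h : J i
  · simp only [mix_of_false h]
    exact (measurable_pi_apply i).comp measurable_snd
  · simp only [mix_of_true h]
    exact (measurable_pi_apply i).comp measurable_fst

theorem measurePreserving_mix (J : ℕ → Bool) :
    MeasurePreserving (fun p : Cantor × Cantor => mix J p.1 p.2)
      ((uniformMeasure ℕ).prod (uniformMeasure ℕ)) (uniformMeasure ℕ) := by
  classical
  refine ⟨measurable_mix J, eq_uniformMeasure fun s t => ?_⟩
  rw [Measure.map_apply (measurable_mix J)
    (MeasurableSet.pi s.countable_toSet fun _ _ => .of_discrete)]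
  have : (fun p : Cantor × Cantor => mix J p.1 p.2) ⁻¹' Set.pi s t =
      Set.pi (s.filter fun i => J i = true : Finset ℕ) t ×ˢ
        Set.pi (s.filter fun i => ¬ J i = true : Finset ℕ) t := by
    ext ⟨x, y⟩
    simp only [Set.mem_preimage, Set.mem_pi, Finset.mem_coe, Set.mem_prod, Finset.mem_filter,
      and_imp]
    constructor
    · intro h
      refine ⟨fun i hi hJ => ?_, fun i hi hJ => ?_⟩
      · simpa [mix_of_true hJ] using h i hi
      · simpa [mix_of_false (Bool.eq_false_iff.2 hJ)] using h i hi
    · rintro ⟨h1, h2⟩ i hi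
      cases hJ : J i
      · rw [mix_of_false hJ]; exact h2 i hi (by simp [hJ])
      · rw [mix_of_true hJ]; exact h1 i hi hJ
  rw [this, Measure.prod_prod, uniformMeasure_pi, uniformMeasure_pi,
    Finset.prod_filter_mul_prod_filter_not]

/-! ### Functions of finitely many bits -/

/-- The sequences that begin with the first `u` bits of `v`. -/
def bitCylinder (u v : ℕ) : Set Cantor := Set.pi (Finset.range u) fun i => {natBits v i}

theorem mem_bitCylinder {u v : ℕ} {x : Cantor} :
    x ∈ bitCylinder u v ↔ ∀ i < u, natBits v i = x i := by
  simp [bitCylinder, Set.mem_pi, eq_comm]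

theorem measurableSet_bitCylinder (u v : ℕ) : MeasurableSet (bitCylinder u v) :=
  MeasurableSet.pi (Finset.range u).countable_toSet fun _ _ => measurableSet_singleton _

theorem measureReal_bitCylinder (u v : ℕ) :
    (uniformMeasure ℕ).real (bitCylinder u v) = ((2 : ℝ) ^ u)⁻¹ := by
  rw [measureReal_def, bitCylinder, uniformMeasure_pi]
  simp

/-- A function of the first `u` bits is constant on each of the `2 ^ u` cylinders of length `u`. -/
theorem eq_sum_indicator_bitCylinder {g : Cantor → ℝ} {u : ℕ} (hg : DependsOn g (Set.Iio u)) :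
    g = fun x => ∑ v ∈ Finset.range (2 ^ u),
      (bitCylinder u v).indicator (fun _ => g (natBits v)) x := by
  funext x
  obtain ⟨v, hv, h⟩ := exists_natBits x u
  rw [Finset.sum_eq_single_of_mem v (Finset.mem_range.2 hv),
    Set.indicator_of_mem (mem_bitCylinder.2 h)]
  · exact hg fun i hi => (h i hi).symm
  · intro w hw hwv
    refine Set.indicator_of_notMem (fun hx => hwv ?_) _
    refine Nat.eq_of_testBit_eq fun i => ?_
    rcases lt_or_ge i u with hi | hi
    · exact (mem_bitCylinder.1 hx i hi).trans (h i hi).symm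
    · have hle : 2 ^ u ≤ 2 ^ i := Nat.pow_le_pow_right (by norm_num) hi
      rw [Nat.testBit_lt_two_pow (lt_of_lt_of_le (Finset.mem_range.1 hw) hle),
        Nat.testBit_lt_two_pow (lt_of_lt_of_le hv hle)]

theorem measurable_of_dependsOn {g : Cantor → ℝ} {u : ℕ} (hg : DependsOn g (Set.Iio u)) :
    Measurable g := by
  rw [eq_sum_indicator_bitCylinder hg]
  exact Finset.measurable_sum _ fun v _ =>
    measurable_const.indicator (measurableSet_bitCylinder u v)

theorem integrable_of_dependsOn {g : Cantor → ℝ} {u : ℕ} (hg : DependsOn g (Set.Iio u)) :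
    Integrable g (uniformMeasure ℕ) := by
  rw [eq_sum_indicator_bitCylinder hg]
  exact integrable_finsetSum _ fun v _ =>
    (integrable_const _).indicator (measurableSet_bitCylinder u v)

theorem integral_of_dependsOn {g : Cantor → ℝ} {u : ℕ} (hg : DependsOn g (Set.Iio u)) :
    ∫ x, g x ∂(uniformMeasure ℕ) =
      (∑ v ∈ Finset.range (2 ^ u), g (natBits v)) * ((2 : ℝ) ^ u)⁻¹ := by
  conv_lhs => rw [eq_sum_indicator_bitCylinder hg]
  rw [integral_finsetSum _ fun v _ =>
    (integrable_const _).indicator (measurableSet_bitCylinder u v), Finset.sum_mul]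
  refine Finset.sum_congr rfl fun v _ => ?_
  rw [integral_indicator_const _ (measurableSet_bitCylinder u v), measureReal_bitCylinder,
    smul_eq_mul, mul_comm]

theorem dependsOn_comp_mix {α : Type} {g : Cantor → α} {u : ℕ} (hg : DependsOn g (Set.Iio u))
    (J : ℕ → Bool) (x : Cantor) : DependsOn (fun y => g (mix J x y)) (Set.Iio u) := by
  intro y z h
  refine hg fun i hi => ?_
  cases hJ : J i
  · rw [mix_of_false hJ, mix_of_false hJ, h i hi]
  · rw [mix_of_true hJ, mix_of_true hJ]

/-! ### Conditional expectation given a set of positions -/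

/-- The conditional expectation of `g` given the bits at the positions in `J`. -/
noncomputable def condE (J : ℕ → Bool) (g : Cantor → ℝ) (x : Cantor) : ℝ :=
  ∫ y, g (mix J x y) ∂(uniformMeasure ℕ)

theorem cast_condAvg {g : Cantor → ℚ} {u : ℕ} (hg : DependsOn g (Set.Iio u)) (J : ℕ → Bool)
    (x : Cantor) : ((condAvg u J g x : ℚ) : ℝ) = condE J (fun y => (g y : ℝ)) x := by
  have h : DependsOn (fun y => (g (mix J x y) : ℝ)) (Set.Iio u) := fun y z hyz => by
    have := dependsOn_comp_mix hg J x hyz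
    dsimp only at this ⊢
    rw [this]
  rw [condE, integral_of_dependsOn h, condAvg]
  push_cast
  rfl

/-- The function `g` only looks at the positions in `J`. -/
abbrev AdaptedTo {α : Type} (J : ℕ → Bool) (g : Cantor → α) : Prop :=
  DependsOn g {p | J p = true}

theorem AdaptedTo.mix {α : Type} {J : ℕ → Bool} {g : Cantor → α} (hg : AdaptedTo J g)
    (x y : Cantor) : g (mix J x y) = g x :=
  hg fun _ hp => mix_of_true hp x y

theorem AdaptedTo.condE_eq {J : ℕ → Bool} {g : Cantor → ℝ} (hg : AdaptedTo J g) :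
    condE J g = g := by
  funext x
  simp [condE, hg.mix]

/-- The tower property. -/
theorem condE_condE {J K : ℕ → Bool} (hKJ : ∀ p, K p = true → J p = true) {g : Cantor → ℝ}
    {u : ℕ} (hg : DependsOn g (Set.Iio u)) : condE K (condE J g) = condE K g := by
  funext x
  have hmix : ∀ y z, mix J (mix K x y) z = mix K x (mix J y z) := by
    intro y z
    funext p
    cases hK : K p
    · rw [mix_of_false hK]
      cases hJ : J p
      · rw [mix_of_false hJ, mix_of_false hJ]
      · rw [mix_of_true hJ, mix_of_true hJ, mix_of_false hK]
    · rw [mix_of_true hK, mix_of_true (hKJ p hK), mix_of_true hK]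
  have hgx := dependsOn_comp_mix hg K x
  have hmp := measurePreserving_mix J
  have hint : Integrable (fun p : Cantor × Cantor => g (mix K x (mix J p.1 p.2)))
      ((uniformMeasure ℕ).prod (uniformMeasure ℕ)) :=
    hmp.integrable_comp_of_integrable (integrable_of_dependsOn hgx)
  have h1 : condE K (condE J g) x =
      ∫ y, ∫ z, g (mix K x (mix J y z)) ∂(uniformMeasure ℕ) ∂(uniformMeasure ℕ) := by
    simp only [condE, hmix]
  rw [h1, ← integral_prod _ hint, condE,
    integral_comp_of_measurePreserving hmp (measurable_of_dependsOn hgx)]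

/-- A conditional expectation may be computed by integrating over the bits outside `K` alone, these
being listed by an injection `e`. -/
theorem integral_eq_condE {ι : Type} {e : ι → ℕ} (he : Function.Injective e) {K : ℕ → Bool}
    {x : Cantor} {c : (ι → Bool) → Cantor} (hc : Measurable c)
    (hcx : ∀ y : Cantor, c (y ∘ e) = mix K x y) {g : Cantor → ℝ} (hg : Measurable g) :
    ∫ ξ, g (c ξ) ∂(uniformMeasure ι) = condE K g x := by
  have hmp := measurePreserving_comp_injective he
  rw [condE, ← integral_comp_of_measurePreserving hmp (g := fun ξ => g (c ξ)) (hg.comp hc)]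
  simp only [hcx]

/-! ### Trading strategies along a sequence of prices -/

section Strategy

/-- The state of an automaton with transition function `step`, started in `0`, after it has read
`y 0, …, y (n - 1)`. -/
def stateSeq (step : ℕ → ℚ → ℕ) (y : ℕ → ℚ) : ℕ → ℕ
  | 0 => 0
  | n + 1 => step (stateSeq step y n) (y n)

/-- The gain, from time `n` to time `m`, of a trader who holds `w s` shares in the state `s`; the
holding from time `i` to time `i + 1` is decided after reading `y i`. -/
def gain (step : ℕ → ℚ → ℕ) (w : ℕ → ℚ) (y : ℕ → ℚ) (n m : ℕ) : ℚ :=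
  ∑ i ∈ Finset.Ico n m, w (stateSeq step y (i + 1)) * (y (i + 1) - y i)

/-- The gain is the increase of `P i = gain - (w s * y i - r s)`, up to a bounded error. Here `P`
changes only when the state does. -/
theorem gain_eq (step : ℕ → ℚ → ℕ) (w r : ℕ → ℚ) (y : ℕ → ℚ) {n m : ℕ} (h : n ≤ m) :
    gain step w y n m =
      (w (stateSeq step y (m + 1)) * y m - r (stateSeq step y (m + 1))) -
      (w (stateSeq step y (n + 1)) * y n - r (stateSeq step y (n + 1))) +
      ∑ i ∈ Finset.Ico n m,
        ((w (stateSeq step y (i + 1)) - w (stateSeq step y (i + 2))) * y (i + 1) +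
          r (stateSeq step y (i + 2)) - r (stateSeq step y (i + 1))) := by
  induction m, h using Nat.le_induction with
  | base => simp [gain]
  | succ m hm ih =>
    rw [gain, Finset.sum_Ico_succ_top hm, ← gain, ih, Finset.sum_Ico_succ_top hm]
    ring

/-- A strategy is safe if its gain minus the liquidation value `w s * y - r s` never decreases and
if this liquidation value is bounded. -/
structure IsSafeStrategy (step : ℕ → ℚ → ℕ) (w r : ℕ → ℚ) (C : ℚ) : Prop where
  nonneg : ∀ s, 0 ≤ w s
  le_one : ∀ s, w s ≤ 1
  bounded : ∀ s y, 0 ≤ y → |w (step s y) * y - r (step s y)| ≤ C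
  switch : ∀ s y, 0 ≤ y → 0 ≤ (w s - w (step s y)) * y + r (step s y) - r s

variable {step : ℕ → ℚ → ℕ} {w r : ℕ → ℚ} {C : ℚ}

/-- The losses of a safe strategy are bounded, from any time on. -/
theorem IsSafeStrategy.le_gain (hs : IsSafeStrategy step w r C) {y : ℕ → ℚ} (hy : ∀ n, 0 ≤ y n)
    {n m : ℕ} (h : n ≤ m) : -(2 * C) ≤ gain step w y n m := by
  rw [gain_eq step w r y h]
  have h1 := abs_le.1 (hs.bounded (stateSeq step y m) (y m) (hy m))
  have h2 := abs_le.1 (hs.bounded (stateSeq step y n) (y n) (hy n))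
  have h3 : 0 ≤ ∑ i ∈ Finset.Ico n m,
        ((w (stateSeq step y (i + 1)) - w (stateSeq step y (i + 2))) * y (i + 1) +
          r (stateSeq step y (i + 2)) - r (stateSeq step y (i + 1))) :=
    Finset.sum_nonneg fun i _ => hs.switch _ _ (hy (i + 1))
  simp only [stateSeq] at h3 ⊢
  linarith [h1.1, h2.2]

theorem exists_sum_gt {p : ℕ → ℚ} (hp : ∀ i, 0 ≤ p i) {δ : ℚ} (hδ : 0 < δ)
    (h : ∀ N, ∃ n ≥ N, δ ≤ p n) (R : ℚ) : ∃ n, R < ∑ i ∈ Finset.range n, p i := by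
  have key : ∀ k : ℕ, ∃ n, k * δ ≤ ∑ i ∈ Finset.range n, p i := by
    intro k
    induction k with
    | zero => exact ⟨0, by simp⟩
    | succ k ih =>
      obtain ⟨n, hn⟩ := ih
      obtain ⟨m, hm, hpm⟩ := h n
      refine ⟨m + 1, ?_⟩
      rw [Finset.sum_range_succ]
      have : ∑ i ∈ Finset.range n, p i ≤ ∑ i ∈ Finset.range m, p i :=
        Finset.sum_le_sum_of_subset_of_nonneg (Finset.range_mono hm) fun i _ _ => hp i
      push_cast
      linarith
  obtain ⟨k, hk⟩ := exists_nat_gt (R / δ)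
  obtain ⟨n, hn⟩ := key k
  exact ⟨n, lt_of_lt_of_le ((div_lt_iff₀ hδ).1 hk) hn⟩

/-- If infinitely many changes of state earn at least `δ`, the gains are unbounded. -/
theorem IsSafeStrategy.exists_gain_gt (hs : IsSafeStrategy step w r C) {y : ℕ → ℚ}
    (hy : ∀ n, 0 ≤ y n) {δ : ℚ} (hδ : 0 < δ)
    (h : ∀ N, ∃ n ≥ N, δ ≤ (w (stateSeq step y (n + 1)) - w (stateSeq step y (n + 2))) * y (n + 1) +
          r (stateSeq step y (n + 2)) - r (stateSeq step y (n + 1))) (R : ℚ) :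
    ∃ n, R < gain step w y 0 n := by
  obtain ⟨n, hn⟩ := exists_sum_gt (fun i => hs.switch _ _ (hy (i + 1))) hδ h (R + 2 * C)
  refine ⟨n, ?_⟩
  rw [gain_eq step w r y (Nat.zero_le n)]
  have h1 := abs_le.1 (hs.bounded (stateSeq step y n) (y n) (hy n))
  have h2 := abs_le.1 (hs.bounded (stateSeq step y 0) (y 0) (hy 0))
  simp only [Nat.Ico_zero_eq_range, stateSeq] at hn h1 h2 ⊢
  linarith [h1.1, h2.2]

/-- Hold `1 / (s + 1)` shares until the price exceeds `2 * (s + 1)`; then raise `s` to a bound of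
the price. Every rise secures a gain of at least `1`. -/
def scaleStep (s : ℕ) (y : ℚ) : ℕ := if 2 * ((s : ℚ) + 1) < y then ⌈y⌉₊ else s

/-- The shares held by the strategy of `scaleStep`. -/
def scaleHold (s : ℕ) : ℚ := 1 / ((s : ℚ) + 1)

theorem scale_switch (s : ℕ) {y : ℚ} (h : 2 * ((s : ℚ) + 1) < y) :
    1 ≤ (scaleHold s - scaleHold (scaleStep s y)) * y := by
  rw [scaleStep, if_pos h, scaleHold, scaleHold, sub_mul]
  have h1 : (0 : ℚ) < (s : ℚ) + 1 := by positivity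
  have h2 : (0 : ℚ) < (⌈y⌉₊ : ℚ) + 1 := by positivity
  have h3 : 2 ≤ 1 / ((s : ℚ) + 1) * y := by
    rw [one_div, ← div_eq_inv_mul, le_div_iff₀ h1]
    exact h.le
  have h4 : 1 / ((⌈y⌉₊ : ℚ) + 1) * y ≤ 1 := by
    rw [one_div, ← div_eq_inv_mul, div_le_one h2]
    linarith [Nat.le_ceil y]
  linarith

theorem isSafeStrategy_scale : IsSafeStrategy scaleStep scaleHold (fun _ => 0) 2 where
  nonneg s := by unfold scaleHold; positivity
  le_one s := by
    rw [scaleHold, div_le_one (by positivity)]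
    linarith [(Nat.cast_nonneg s : (0 : ℚ) ≤ s)]
  bounded s y hy := by
    rw [sub_zero, abs_of_nonneg (mul_nonneg (by unfold scaleHold; positivity) hy), scaleHold,
      one_div, ← div_eq_inv_mul, div_le_iff₀ (by positivity), scaleStep]
    split_ifs with h
    · linarith [Nat.le_ceil y]
    · linarith
  switch s y hy := by
    by_cases h : 2 * ((s : ℚ) + 1) < y
    · linarith [scale_switch s h]
    · simp [scaleStep, h]

theorem exists_gain_scale_gt {y : ℕ → ℚ} (hy : ∀ n, 0 ≤ y n) (h : ∀ B : ℚ, ∀ N, ∃ n ≥ N, B < y n)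
    (R : ℚ) : ∃ n, R < gain scaleStep scaleHold y 0 n := by
  refine isSafeStrategy_scale.exists_gain_gt hy one_pos (fun N => ?_) R
  -- otherwise the state is constant from `N` on, and so the prices are bounded
  by_contra! hcon
  have hno : ∀ n ≥ N, ¬ 2 * ((stateSeq scaleStep y (n + 1) : ℚ) + 1) < y (n + 1) := by
    intro n hn hlt
    have h1 := scale_switch _ hlt
    have h2 := hcon n hn
    simp only [stateSeq] at h1 h2
    linarith
  have hconst : ∀ n ≥ N, stateSeq scaleStep y (n + 1) = stateSeq scaleStep y (N + 1) := by
    intro n hn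
    induction n, hn using Nat.le_induction with
    | base => rfl
    | succ n hn ih => rw [← ih, stateSeq, scaleStep, if_neg (hno n hn)]
  obtain ⟨n, hn, hlt⟩ := h (2 * ((stateSeq scaleStep y (N + 1) : ℚ) + 1)) (N + 1)
  obtain ⟨k, rfl⟩ : ∃ k, n = k + 1 := ⟨n - 1, by omega⟩
  exact hno k (by omega) (by rwa [hconst k (by omega)])

/-- Hold one share (state `1`) from the time the price falls below `a` to the time it exceeds `b`,
and nothing (state `0`) the rest of the time. -/
def crossStep (a b : ℚ) (s : ℕ) (y : ℚ) : ℕ := if y < a then 1 else if b < y then 0 else s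

/-- The shares held by the strategy of `crossStep`. -/
def crossHold (s : ℕ) : ℚ := if s = 0 then 0 else 1

theorem isSafeStrategy_cross {a b : ℚ} (ha : 0 ≤ a) (hab : a < b) :
    IsSafeStrategy (crossStep a b) crossHold (fun s => a * crossHold s) b where
  nonneg s := by unfold crossHold; split_ifs <;> norm_num
  le_one s := by unfold crossHold; split_ifs <;> norm_num
  bounded s y hy := by
    rw [mul_comm a, ← mul_sub]
    by_cases h1 : y < a
    · simp only [crossStep, h1, if_true, crossHold, one_ne_zero, if_false, one_mul, abs_le]
      constructor <;> linarith
    by_cases h2 : b < y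
    · simp only [crossStep, h1, h2, if_true, crossHold, if_false, zero_mul, abs_zero]
      linarith
    simp only [crossStep, h1, h2, if_false]
    unfold crossHold
    split_ifs
    · rw [zero_mul, abs_zero]; linarith
    · rw [one_mul, abs_le]; constructor <;> linarith
  switch s y hy := by
    have : (crossHold s - crossHold (crossStep a b s y)) * y + a * crossHold (crossStep a b s y)
        - a * crossHold s = (crossHold s - crossHold (crossStep a b s y)) * (y - a) := by ring
    rw [this]
    by_cases h1 : y < a
    · simp only [crossStep, h1, if_true]
      refine mul_nonneg_of_nonpos_of_nonpos ?_ (by linarith)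
      unfold crossHold; split_ifs <;> simp_all
    by_cases h2 : b < y
    · simp only [crossStep, h1, h2, if_true, if_false]
      refine mul_nonneg ?_ (by linarith)
      unfold crossHold; split_ifs <;> simp_all
    simp [crossStep, h1, h2]

theorem exists_gain_cross_gt {y : ℕ → ℚ} (hy : ∀ n, 0 ≤ y n) {a b : ℚ} (hab : a < b)
    (hlow : ∀ N, ∃ n ≥ N, y n < a) (hhigh : ∀ N, ∃ n ≥ N, b < y n) (R : ℚ) :
    ∃ n, R < gain (crossStep a b) crossHold y 0 n := by
  obtain ⟨k, -, hk⟩ := hlow 0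
  have ha : 0 ≤ a := (hy k).trans hk.le
  refine (isSafeStrategy_cross ha hab).exists_gain_gt hy (sub_pos.2 hab) (fun N => ?_) R
  obtain ⟨n, hn, hya⟩ := hlow N
  obtain ⟨m, hm, hyb⟩ := hhigh n
  -- the share bought by time `n` has been sold at time `m`
  by_contra! hcon
  have hon : ∀ j ≥ n, stateSeq (crossStep a b) y (j + 1) ≠ 0 := by
    intro j hj
    induction j, hj using Nat.le_induction with
    | base => simp [stateSeq, crossStep, hya]
    | succ j hj ih =>
      intro h0
      have hb : b < y (j + 1) := by
        by_contra hb
        rw [stateSeq, crossStep, if_neg hb] at h0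
        split_ifs at h0
        exact ih h0
      have := hcon j (by omega)
      rw [h0] at this
      simp only [crossHold, ih, if_true, if_false] at this
      linarith
  have hna : ¬ y m < a := by linarith
  exact hon m hm (by simp [stateSeq, crossStep, hna, hyb])

end Strategy

/-! ### Approximate martingales and their exact descendants -/

/-- An increasing, uniformly decidable sequence of sets of positions. -/
structure IsFiltration (J : ℕ → ℕ → Bool) : Prop where
  computable : Computable₂ J
  mono : ∀ m n, m ≤ n → ∀ p, J m p = true → J n p = true

/-- A computable sequence of nonnegative rational functions that is a martingale for `J` up to
summable errors. -/
structure IsApproxMartingale (J : ℕ → ℕ → Bool) (q : ℕ → Cantor → ℚ) : Prop where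
  computable : IsRatTruthTable fun x n => q n x
  nonneg : ∀ n x, 0 ≤ q n x
  adapted : ∀ n, AdaptedTo (J n) (q n)
  condE_le : ∀ n x, |condE (J n) (fun y => (q (n + 1) y : ℝ)) x - q n x| ≤ (1 / 2 : ℝ) ^ n

/-- A computable, nonnegative rational martingale for the filtration `K`. -/
structure IsExactMartingale (K : ℕ → ℕ → Bool) (D : ℕ → Cantor → ℚ) : Prop where
  computable : IsRatTruthTable fun x n => D n x
  nonneg : ∀ n x, 0 ≤ D n x
  adapted : ∀ n, AdaptedTo (K n) (D n)
  condE_eq : ∀ m n, m ≤ n → ∀ x, condE (K m) (fun y => (D n y : ℝ)) x = D m x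

theorem adaptedTo_condAvg (u : ℕ) (J : ℕ → Bool) (g : Cantor → ℚ) :
    AdaptedTo J (condAvg u J g) := by
  intro x y h
  unfold condAvg
  congr 1
  refine Finset.sum_congr rfl fun v _ => congrArg g (funext fun p => ?_)
  cases hp : J p
  · rw [mix_of_false hp, mix_of_false hp]
  · rw [mix_of_true hp, mix_of_true hp, h p hp]

theorem sum_Ico_half_le (n m : ℕ) : ∑ i ∈ Finset.Ico n m, (1 / 2 : ℚ) ^ i ≤ 2 := by
  have h : ∀ m, ∑ i ∈ Finset.range m, (1 / 2 : ℚ) ^ i = 2 - 2 * (1 / 2) ^ m := by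
    intro m
    induction m with
    | zero => simp
    | succ m ih => rw [Finset.sum_range_succ, ih, pow_succ]; ring
  calc ∑ i ∈ Finset.Ico n m, (1 / 2 : ℚ) ^ i ≤ ∑ i ∈ Finset.range m, (1 / 2 : ℚ) ^ i := by
        rw [← Nat.Ico_zero_eq_range]
        exact Finset.sum_le_sum_of_subset_of_nonneg
          (Finset.Ico_subset_Ico_left (Nat.zero_le n)) fun i _ _ => by positivity
    _ ≤ 2 := by
        rw [h]
        linarith [show (0 : ℚ) ≤ (1 / 2) ^ m by positivity]

/-- The martingale transform of the approximate martingale `q` by the holdings `H`: the increments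
of `q` are replaced by exact martingale differences. -/
def transform (c : ℚ) (u : ℕ → ℕ) (J : ℕ → ℕ → Bool) (q H : ℕ → Cantor → ℚ) (n : ℕ)
    (x : Cantor) : ℚ :=
  c + ∑ i ∈ Finset.range n, H i x * (q (i + 1) x - condAvg (u i) (J i) (q (i + 1)) x)

section Transform

variable {J : ℕ → ℕ → Bool} {q H : ℕ → Cantor → ℚ} {c C : ℚ} {u : ℕ → ℕ}

theorem isRatTruthTable_transform (hJ : IsFiltration J) (hq : IsApproxMartingale J q)
    (hH : IsRatTruthTable fun x n => H n x) (hu : Computable u) :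
    IsRatTruthTable fun x n => transform c u J q H n x := by
  have hq1 : IsRatTruthTable fun x n => q (n + 1) x :=
    hq.computable.comp_computable Computable.succ
  have hinc := hH.mul (hq1.sub (hq1.condAvg hu hJ.computable))
  have hsum := ((hinc.comp_computable (Computable.snd (α := Unit) (β := ℕ))).sum).comp_computable
    ((Computable.const ()).pair Computable.id)
  exact (isRatTruthTable_const c).add hsum

theorem adaptedTo_transform (hJ : IsFiltration J) (hq : IsApproxMartingale J q)
    (hH : ∀ n, AdaptedTo (J n) (H n)) (n : ℕ) : AdaptedTo (J n) (transform c u J q H n) := by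
  intro x y h
  unfold transform
  congr 1
  refine Finset.sum_congr rfl fun i hi => ?_
  have hi := Finset.mem_range.1 hi
  have h1 : ∀ k ≤ n, ∀ p, J k p = true → x p = y p := fun k hk p hp => h p (hJ.mono k n hk p hp)
  rw [hH i (h1 i hi.le), hq.adapted (i + 1) (h1 (i + 1) hi),
    adaptedTo_condAvg (u i) (J i) _ (h1 i hi.le)]

theorem transform_succ (n : ℕ) (x : Cantor) : transform c u J q H (n + 1) x =
    transform c u J q H n x + H n x * (q (n + 1) x - condAvg (u n) (J n) (q (n + 1)) x) := by
  rw [transform, Finset.sum_range_succ, ← add_assoc, ← transform]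

theorem condE_transform_succ (hJ : IsFiltration J) (hq : IsApproxMartingale J q)
    (hH : ∀ n, AdaptedTo (J n) (H n)) (hu : ∀ n, DependsOn (q (n + 1)) (Set.Iio (u n))) (n : ℕ) :
    condE (J n) (fun y => (transform c u J q H (n + 1) y : ℝ)) =
      fun x => (transform c u J q H n x : ℝ) := by
  funext x
  have h1 : DependsOn (fun y => (q (n + 1) (mix (J n) x y) : ℝ)) (Set.Iio (u n)) := fun y z h => by
    have := dependsOn_comp_mix (hu n) (J n) x h
    dsimp only at this ⊢
    rw [this]
  have h2 := integrable_of_dependsOn h1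
  have h3 : ∀ y, (transform c u J q H (n + 1) (mix (J n) x y) : ℝ) =
      transform c u J q H n x + H n x * (q (n + 1) (mix (J n) x y) -
        condE (J n) (fun y => (q (n + 1) y : ℝ)) x) := by
    intro y
    rw [transform_succ, (adaptedTo_transform hJ hq hH n).mix, (hH n).mix,
      (adaptedTo_condAvg (u n) (J n) _).mix, ← cast_condAvg (hu n)]
    push_cast
    rfl
  have h4 : condE (J n) (fun y => (q (n + 1) y : ℝ)) x =
      ∫ y, (q (n + 1) (mix (J n) x y) : ℝ) ∂(uniformMeasure ℕ) := rfl
  have h5 : ∫ y, ((q (n + 1) (mix (J n) x y) : ℝ) -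
      condE (J n) (fun y => (q (n + 1) y : ℝ)) x) ∂(uniformMeasure ℕ) = 0 := by
    rw [integral_sub h2 (integrable_const _), h4]
    simp
  have h6 : Integrable (fun y => (H n x : ℝ) * ((q (n + 1) (mix (J n) x y) : ℝ) -
      condE (J n) (fun y => (q (n + 1) y : ℝ)) x)) (uniformMeasure ℕ) :=
    (h2.sub (integrable_const _)).const_mul _
  rw [condE]
  simp only [h3]
  rw [integral_add (integrable_const _) h6, integral_const_mul, h5]
  simp

theorem condE_transform (hJ : IsFiltration J) (hq : IsApproxMartingale J q)
    (hH : ∀ n, AdaptedTo (J n) (H n)) (hu : ∀ n, DependsOn (q (n + 1)) (Set.Iio (u n)))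
    (hT : ∀ n, ∃ v, DependsOn (transform c u J q H n) (Set.Iio v)) {n m : ℕ} (h : n ≤ m) :
    condE (J n) (fun y => (transform c u J q H m y : ℝ)) =
      fun x => (transform c u J q H n x : ℝ) := by
  induction m, h using Nat.le_induction with
  | base =>
    refine AdaptedTo.condE_eq fun x y hxy => ?_
    rw [adaptedTo_transform hJ hq hH n hxy]
  | succ m hm ih =>
    obtain ⟨v, hv⟩ := hT (m + 1)
    have hv' : DependsOn (fun y => (transform c u J q H (m + 1) y : ℝ)) (Set.Iio v) :=
      fun x y hxy => by dsimp only; rw [hv hxy]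
    rw [← condE_condE (hJ.mono n m hm) hv', condE_transform_succ hJ hq hH hu, ih]

/-- The transform follows the gain of the holdings `H` on `q`, up to the sum of the errors. -/
theorem le_transform_sub (hq : IsApproxMartingale J q)
    (hH0 : ∀ n x, 0 ≤ H n x) (hH1 : ∀ n x, H n x ≤ 1)
    (hu : ∀ n, DependsOn (q (n + 1)) (Set.Iio (u n))) (x : Cantor) {n m : ℕ} (h : n ≤ m) :
    ∑ i ∈ Finset.Ico n m, H i x * (q (i + 1) x - q i x) - 2 ≤
      transform c u J q H m x - transform c u J q H n x := by
  have h1 : transform c u J q H m x - transform c u J q H n x =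
      ∑ i ∈ Finset.Ico n m, H i x * (q (i + 1) x - condAvg (u i) (J i) (q (i + 1)) x) := by
    rw [Finset.sum_Ico_eq_sub _ h, transform, transform]
    ring
  have h2 : ∑ i ∈ Finset.Ico n m, (H i x * (q (i + 1) x - q i x) - (1 / 2 : ℚ) ^ i) ≤
      ∑ i ∈ Finset.Ico n m, H i x * (q (i + 1) x - condAvg (u i) (J i) (q (i + 1)) x) := by
    refine Finset.sum_le_sum fun i _ => ?_
    have h3 : |condAvg (u i) (J i) (q (i + 1)) x - q i x| ≤ (1 / 2 : ℚ) ^ i := by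
      have := hq.condE_le i x
      rw [← cast_condAvg (hu i)] at this
      rw [← Rat.cast_le (K := ℝ)]
      push_cast
      exact this
    have h4 : H i x * (condAvg (u i) (J i) (q (i + 1)) x - q i x) ≤ 1 * (1 / 2 : ℚ) ^ i := by
      refine (mul_le_mul_of_nonneg_left (le_of_abs_le h3) (hH0 i x)).trans ?_
      exact mul_le_mul_of_nonneg_right (hH1 i x) (by positivity)
    linarith
  rw [Finset.sum_sub_distrib] at h2
  linarith [sum_Ico_half_le n m]

/-- A strategy for an approximate martingale whose losses are bounded, from any time on and on every
sequence, and whose gains at `ω` are unbounded, yields an exact martingale that tends to infinity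
at `ω`. The filtration `K` of the new martingale may differ from `J`, as long as each `K n` is
contained in some `J (l n)`: since losses are bounded, the expected future capital given `K n` is
large as soon as `K n` determines that a large capital has been reached. -/
theorem exists_exactMartingale_of_strategy {K : ℕ → ℕ → Bool} {l : ℕ → ℕ}
    (hJ : IsFiltration J) (hK : IsFiltration K) (hKex : ∀ p, ∃ n, K n p = true)
    (hl : Computable l) (hKJ : ∀ n p, K n p = true → J (l n) p = true) (hln : ∀ n, n ≤ l n)
    (hq : IsApproxMartingale J q) (hHc : IsRatTruthTable fun x n => H n x)
    (hH : ∀ n, AdaptedTo (J n) (H n)) (hH0 : ∀ n x, 0 ≤ H n x) (hH1 : ∀ n x, H n x ≤ 1)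
    (hloss : ∀ x n m, n ≤ m → -C ≤ ∑ i ∈ Finset.Ico n m, H i x * (q (i + 1) x - q i x))
    {ω : Cantor}
    (hgain : ∀ R, ∃ n, R < ∑ i ∈ Finset.Ico 0 n, H i ω * (q (i + 1) ω - q i ω)) :
    ∃ D, IsExactMartingale K D ∧ Tendsto (fun n => D n ω) atTop atTop := by
  obtain ⟨u', hu', hqu'⟩ := hq.computable.dependsOn
  set u : ℕ → ℕ := fun n => u' (n + 1) with hu_def
  have huc : Computable u := hu'.comp Computable.succ
  have hu : ∀ n, DependsOn (q (n + 1)) (Set.Iio (u n)) := fun n => hqu' (n + 1)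
  set T : ℕ → Cantor → ℚ := transform (C + 2) u J q H with hT_def
  have hTc : IsRatTruthTable fun x n => T n x := isRatTruthTable_transform hJ hq hHc huc
  obtain ⟨v, hv, hTv⟩ := hTc.dependsOn
  have hTv' : ∀ n, DependsOn (fun x => (T n x : ℝ)) (Set.Iio (v n)) := fun n x y h => by
    have := hTv n h
    dsimp only at this ⊢
    rw [this]
  have hsave : ∀ x n m, n ≤ m → T n x - (C + 2) ≤ T m x := fun x n m h => by
    have h1 := le_transform_sub (c := C + 2) hq hH0 hH1 hu x h
    have h2 := hloss x n m h
    linarith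
  have hT0 : ∀ n x, 0 ≤ T n x := fun n x => by
    have := hsave x 0 n (Nat.zero_le n)
    simpa [hT_def, transform] using this
  have hcond : ∀ n m, n ≤ m → condE (J n) (fun y => (T m y : ℝ)) = fun x => (T n x : ℝ) :=
    fun n m h => condE_transform hJ hq hH hu (fun n => ⟨v n, hTv n⟩) h
  have hD : ∀ n x, ((condAvg (v (l n)) (K n) (T (l n)) x : ℚ) : ℝ) =
      condE (K n) (fun y => (T (l n) y : ℝ)) x := fun n x => cast_condAvg (hTv (l n)) (K n) x
  -- given `K m`, all the `T k` with `k ≥ l m` have the same conditional expectation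
  have htower : ∀ m k k', k ≤ k' → (∀ p, K m p = true → J k p = true) →
      condE (K m) (fun y => (T k' y : ℝ)) = condE (K m) (fun y => (T k y : ℝ)) := by
    intro m k k' hk hKJ'
    rw [← condE_condE hKJ' (hTv' k'), hcond k k' hk]
  refine ⟨fun n => condAvg (v (l n)) (K n) (T (l n)), ⟨?_, ?_, ?_, ?_⟩, ?_⟩
  · exact (hTc.comp_computable hl).condAvg (hv.comp hl) hK.computable
  · intro n x
    exact mul_nonneg (Finset.sum_nonneg fun _ _ => hT0 _ _) (by positivity)
  · exact fun n => adaptedTo_condAvg _ _ _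
  · intro m n hmn x
    simp only [hD]
    rw [condE_condE (hK.mono m n hmn) (hTv' (l n))]
    rcases le_total (l m) (l n) with h | h
    · rw [htower m (l m) (l n) h (hKJ m)]
    · rw [htower m (l n) (l m) h fun p hp => hKJ n p (hK.mono m n hmn p hp)]
  · refine tendsto_atTop.2 fun R => ?_
    obtain ⟨k, hk⟩ := hgain (R + 2)
    have hTk : R ≤ T k ω - (C + 2) := by
      have h1 := le_transform_sub (c := C + 2) (x := ω) hq hH0 hH1 hu (Nat.zero_le k)
      have h2 : T 0 ω = C + 2 := by simp [hT_def, transform]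
      change _ ≤ T k ω - T 0 ω at h1
      linarith
    choose N hN using hKex
    filter_upwards [eventually_ge_atTop (max k ((Finset.range (v k)).sup N))] with n hn
    have hmix : ∀ y, T k (mix (K n) ω y) = T k ω := fun y => hTv k fun p hp =>
      mix_of_true (hK.mono (N p) n ((Finset.le_sup (Finset.mem_range.2 hp)).trans
        ((le_max_right _ _).trans hn)) p (hN p)) ω y
    rw [← Rat.cast_le (K := ℝ), hD]
    calc (R : ℝ) = ∫ _, (R : ℝ) ∂(uniformMeasure ℕ) := by simp
      _ ≤ ∫ y, (T (l n) (mix (K n) ω y) : ℝ) ∂(uniformMeasure ℕ) := by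
        refine integral_mono (integrable_const _)
          (integrable_of_dependsOn (dependsOn_comp_mix (hTv' (l n)) (K n) ω)) fun y => ?_
        have h1 := hsave (mix (K n) ω y) k (l n)
          (((le_max_left _ _).trans hn).trans (hln n))
        rw [hmix] at h1
        exact Rat.cast_le.2 (hTk.trans h1)

end Transform

/-! ### From divergence to an exact martingale tending to infinity -/

section Divergence

variable {J K : ℕ → ℕ → Bool} {l : ℕ → ℕ} {q : ℕ → Cantor → ℚ} {step : ℕ → ℚ → ℕ} {w r : ℕ → ℚ}
  {C : ℚ}

theorem computable_scaleStep : Computable fun p : ℕ × ℕ => scaleStep p.1 (ratOfCode p.2) := by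
  have h1 : Computable fun p : ℕ × ℕ => mkCode (2 * (p.1 + 1)) 0 0 :=
    computable_mkCode (computable_nat_mul.comp (Computable.const 2)
      (Computable.succ.comp Computable.fst)) (Computable.const 0) (Computable.const 0)
  have h2 : Computable fun p : ℕ × ℕ =>
      decide (ratOfCode (mkCode (2 * (p.1 + 1)) 0 0) < ratOfCode p.2) :=
    computable_ratOfCode_lt.comp h1 Computable.snd
  refine (computable_ite h2 (computable_ceil_ratOfCode.comp Computable.snd)
    Computable.fst).of_eq fun p => ?_
  have h3 : ratOfCode (mkCode (2 * (p.1 + 1)) 0 0) = 2 * ((p.1 : ℚ) + 1) := by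
    rw [ratOfCode_mkCode]
    push_cast
    ring
  rw [h3, scaleStep]

theorem computable_crossStep (a b : ℚ) :
    Computable fun p : ℕ × ℕ => crossStep a b p.1 (ratOfCode p.2) := by
  obtain ⟨i, rfl⟩ := ratOfCode_surjective a
  obtain ⟨j, rfl⟩ := ratOfCode_surjective b
  have h1 : Computable fun p : ℕ × ℕ => decide (ratOfCode p.2 < ratOfCode i) :=
    computable_ratOfCode_lt.comp Computable.snd (Computable.const i)
  have h2 : Computable fun p : ℕ × ℕ => decide (ratOfCode j < ratOfCode p.2) :=
    computable_ratOfCode_lt.comp (Computable.const j) Computable.snd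
  exact computable_ite h1 (Computable.const 1) (computable_ite h2 (Computable.const 0)
    Computable.fst)

theorem isRatTruthTable_hold (hq : IsApproxMartingale J q)
    (hstep : Computable fun p : ℕ × ℕ => step p.1 (ratOfCode p.2)) {wc : ℕ → ℕ}
    (hwc : Computable wc) (hw : ∀ s, ratOfCode (wc s) = w s) :
    IsRatTruthTable fun x i => w (stateSeq step (fun n => q n x) (i + 1)) := by
  obtain ⟨c, hc, hcq⟩ := hq.computable
  have h1 := (IsTruthTable.natRec (s₀ := 0) hstep (hc.comp_computable
    (Computable.snd (α := Unit) (β := ℕ)))).comp_computable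
    ((Computable.const ()).pair Computable.succ)
  refine ⟨_, isTruthTable_comp hwc h1, fun x i => ?_⟩
  rw [hw]
  have h2 : ∀ n, Nat.rec (motive := fun _ => ℕ) 0 (fun i s => step s (ratOfCode (c x i))) n =
      stateSeq step (fun n => q n x) n := by
    intro n
    induction n with
    | zero => rfl
    | succ n ih =>
      dsimp only
      rw [stateSeq, ih, hcq]
  exact congrArg w (h2 (i + 1))

theorem stateSeq_congr {y z : ℕ → ℚ} {n : ℕ} (h : ∀ i < n, y i = z i) :
    stateSeq step y n = stateSeq step z n := by
  induction n with
  | zero => rfl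
  | succ n ih => rw [stateSeq, stateSeq, ih fun i hi => h i (by omega), h n (by omega)]

/-- The case of `exists_exactMartingale_of_strategy` where the holdings are those of a safe strategy
that reads the values of `q`. -/
theorem exists_exactMartingale_of_safe (hJ : IsFiltration J) (hK : IsFiltration K)
    (hKex : ∀ p, ∃ n, K n p = true) (hl : Computable l)
    (hKJ : ∀ n p, K n p = true → J (l n) p = true) (hln : ∀ n, n ≤ l n)
    (hq : IsApproxMartingale J q)
    (hstep : Computable fun p : ℕ × ℕ => step p.1 (ratOfCode p.2)) {wc : ℕ → ℕ}
    (hwc : Computable wc) (hw : ∀ s, ratOfCode (wc s) = w s) (hs : IsSafeStrategy step w r C)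
    {ω : Cantor} (hgain : ∀ R, ∃ n, R < gain step w (fun n => q n ω) 0 n) :
    ∃ D, IsExactMartingale K D ∧ Tendsto (fun n => D n ω) atTop atTop := by
  refine exists_exactMartingale_of_strategy (C := 2 * C)
    (H := fun i x => w (stateSeq step (fun n => q n x) (i + 1))) hJ hK hKex hl hKJ hln hq
    (isRatTruthTable_hold hq hstep hwc hw) (fun n x y h => ?_) (fun _ _ => hs.nonneg _)
    (fun _ _ => hs.le_one _) (fun x n m h => hs.le_gain (fun n => hq.nonneg n x) h) hgain
  exact congrArg w (stateSeq_congr fun i hi => hq.adapted i fun p hp =>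
    h p (hJ.mono i n (by omega) p hp))

/-- The transfer between filtrations: divergence at `ω` of an approximate martingale for `J` gives
an exact martingale for `K` that tends to infinity at `ω`. If `q` is bounded at `ω`, it oscillates
there, and one trades on its crossings of an interval; otherwise one trades on its growth. -/
theorem exists_exactMartingale (hJ : IsFiltration J) (hK : IsFiltration K)
    (hKex : ∀ p, ∃ n, K n p = true) (hl : Computable l)
    (hKJ : ∀ n p, K n p = true → J (l n) p = true) (hln : ∀ n, n ≤ l n)
    (hq : IsApproxMartingale J q) {ω : Cantor}
    (hω : ¬ ∃ a : ℝ, Tendsto (fun n => (q n ω : ℝ)) atTop (𝓝 a)) :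
    ∃ D, IsExactMartingale K D ∧ Tendsto (fun n => D n ω) atTop atTop := by
  by_cases hbdd : ∃ B : ℚ, ∃ N, ∀ n ≥ N, q n ω ≤ B
  · -- the prices oscillate
    obtain ⟨a, b, hab, hlow, hhigh⟩ : ∃ a b : ℚ, a < b ∧ (∃ᶠ n in atTop, q n ω < a) ∧
        ∃ᶠ n in atTop, b < q n ω := by
      by_contra! hcon
      refine hω (tendsto_of_no_upcrossings (Rat.denseRange_cast (𝕜 := ℝ)) ?_ ?_ ?_)
      · rintro _ ⟨a, rfl⟩ _ ⟨b, rfl⟩ hab ⟨h1, h2⟩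
        simp only [Rat.cast_lt] at hab h1 h2
        exact h2 ((hcon a b hab h1).mono fun n hn => not_lt.2 hn)
      · obtain ⟨B, N, h⟩ := hbdd
        exact ⟨B, eventually_map.2 ((eventually_ge_atTop N).mono fun n hn =>
          Rat.cast_le.2 (h n hn))⟩
      · exact ⟨0, eventually_map.2 (.of_forall fun n =>
          Rat.cast_nonneg.2 (hq.nonneg n ω))⟩
    have ha : 0 ≤ a := by
      obtain ⟨n, hn⟩ := hlow.exists
      exact (hq.nonneg n ω).trans hn.le
    have hwc : Computable fun s => mkCode s 0 (s - 1) :=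
      computable_mkCode Computable.id (Computable.const 0) Computable.pred
    refine exists_exactMartingale_of_safe hJ hK hKex hl hKJ hln hq (computable_crossStep a b) hwc
      (fun s => ?_) (isSafeStrategy_cross ha hab)
      (exists_gain_cross_gt (fun n => hq.nonneg n ω) hab (frequently_atTop.1 hlow)
        (frequently_atTop.1 hhigh))
    rw [ratOfCode_mkCode, crossHold]
    cases s with
    | zero => simp
    | succ s =>
      have : (s : ℚ) + 1 ≠ 0 := by positivity
      simp [this]
  · push Not at hbdd
    have hwc : Computable fun s => mkCode 1 0 s :=
      computable_mkCode (Computable.const 1) (Computable.const 0) Computable.id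
    refine exists_exactMartingale_of_safe hJ hK hKex hl hKJ hln hq computable_scaleStep hwc
      (fun s => ?_) isSafeStrategy_scale
      (exists_gain_scale_gt (fun n => hq.nonneg n ω) fun B N => hbdd B N)
    rw [ratOfCode_mkCode, scaleHold]
    simp

end Divergence

/-! ### Orderings of the positions -/

/-- `A` is a decidable set of positions; `a` lists `A` and `b` lists its complement, both without
repetitions, and `inv p` is the place of `p` in the list where it occurs. -/
structure IsSplitting (A : ℕ → Bool) (a b inv : ℕ → ℕ) : Prop where
  computable_set : Computable A
  computable_left : Computable a
  computable_right : Computable b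
  computable_inv : Computable inv
  left_inv : ∀ p, A p = true → a (inv p) = p
  right_inv : ∀ p, A p = false → b (inv p) = p
  set_left : ∀ n, A (a n) = true
  set_right : ∀ n, A (b n) = false
  injective_left : Function.Injective a
  injective_right : Function.Injective b

/-- The sequence with the bits of `γ` at the positions in `A`, and the bits of `α` elsewhere. -/
def merge (A : ℕ → Bool) (inv : ℕ → ℕ) (γ α : Cantor) : Cantor :=
  fun p => bif A p then γ (inv p) else α (inv p)

/-- The positions in `A`, together with the first `n` others. -/
def stage (A : ℕ → Bool) (inv : ℕ → ℕ) (n p : ℕ) : Bool := A p || decide (inv p < n)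

/-- The positions in the first `n` rows. -/
def rowsBelow (n p : ℕ) : Bool := decide (p.unpair.1 < n)

/-- The positions on or above the graph of `f`. -/
def aboveSet (f : ℕ → ℕ) (p : ℕ) : Bool := decide (f p.unpair.1 < p.unpair.2 + 1)

theorem aboveSet_eq_true {f : ℕ → ℕ} {p : ℕ} : aboveSet f p = true ↔ p.unpair ∈ posAbove f := by
  simp [aboveSet, posAbove]

theorem aboveSet_eq_false {f : ℕ → ℕ} {p : ℕ} : aboveSet f p = false ↔ p.unpair ∈ posBelow f := by
  simp only [aboveSet, posBelow, decide_eq_false_iff_not, Set.mem_ofPred_eq]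
  omega

theorem computable_aboveSet {f : ℕ → ℕ} (hf : Computable f) : Computable (aboveSet f) :=
  computable_nat_lt.comp (hf.comp (Computable.fst.comp Computable.unpair))
    (Computable.succ.comp (Computable.snd.comp Computable.unpair))

theorem isFiltration_rowsBelow : IsFiltration rowsBelow where
  computable := computable_nat_lt.comp (Computable.fst.comp (Computable.unpair.comp
    Computable.snd)) Computable.fst
  mono m n h p hp := by
    simp only [rowsBelow, decide_eq_true_eq] at hp ⊢
    omega

theorem isFiltration_above_or_rowsBelow {A : ℕ → Bool} (hA : Computable A) :
    IsFiltration fun n p => A p || rowsBelow n p where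
  computable := computable_bool_or.comp (hA.comp Computable.snd) isFiltration_rowsBelow.computable
  mono m n h p hp := by
    rw [Bool.or_eq_true] at hp ⊢
    exact hp.imp_right (isFiltration_rowsBelow.mono m n h p)

/-- An infinite decidable set of positions has a computable ordering: its increasing one. -/
theorem exists_isComputableOrdering {c : ℕ → Bool} (hc : Computable c) {C : Set (ℕ × ℕ)}
    (hC : C.Infinite) (h : ∀ p, c p = true ↔ p.unpair ∈ C) : ∃ e, IsComputableOrdering C e := by
  have hinf : {p | c p = true}.Infinite := by
    refine fun hfin => hC ((hfin.image Nat.unpair).subset fun p hp => ?_)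
    exact ⟨Nat.pair p.1 p.2, (h _).2 (by simpa using hp), by simp⟩
  -- `count (k, n)` is the number of elements below `n`
  let count : ℕ → ℕ := Nat.count fun p => c p = true
  have hcount : Computable count := by
    have h1 : Computable fun q : (Unit × ℕ) × ℕ => bif c q.1.2 then q.2 + 1 else q.2 :=
      Computable.cond (hc.comp (Computable.snd.comp Computable.fst))
        (Computable.succ.comp Computable.snd) Computable.snd
    refine ((computable_natRec (Computable.const 0) h1).comp
      ((Computable.const ()).pair Computable.id)).of_eq fun n => ?_
    dsimp only [id]
    induction n with
    | zero => simp [count]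
    | succ n ih =>
      dsimp only
      rw [ih]
      simp only [count, Nat.count_succ]
      cases c n <;> simp
  have hex : ∀ n, ∃ p, (c p && decide (count p = n)) = true := fun n => by
    refine ⟨Nat.nth (fun p => c p = true) n, ?_⟩
    rw [Bool.and_eq_true, decide_eq_true_eq]
    exact ⟨Nat.nth_mem_of_infinite hinf n, Nat.count_nth_of_infinite hinf n⟩
  have hnth : Computable (Nat.nth fun p => c p = true) := by
    refine computable_find (p := fun n p => c p && decide (count p = n)) ?_ hex fun n => ?_
    · exact computable_bool_and.comp (hc.comp Computable.snd)
        (computable_nat_eq.comp (hcount.comp Computable.snd) Computable.fst)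
    · have := Nat.find_spec (hex n)
      rw [Bool.and_eq_true, decide_eq_true_eq] at this
      exact (congrArg _ this.2.symm).trans (Nat.nth_count (p := fun p => c p = true) this.1)
  refine ⟨fun n => (Nat.nth (fun p => c p = true) n).unpair, Computable.unpair.comp hnth, ?_, ?_⟩
  · intro n m hnm
    exact Nat.nth_injective hinf (Nat.pairEquiv.symm.injective hnm)
  · ext p
    constructor
    · rintro ⟨n, rfl⟩
      exact (h _).1 (Nat.nth_mem_of_infinite hinf n)
    · intro hp
      have hp' : c (Nat.pair p.1 p.2) = true := (h _).2 (by simpa using hp)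
      refine ⟨count (Nat.pair p.1 p.2), ?_⟩
      dsimp only [count]
      rw [Nat.nth_count (p := fun p => c p = true) hp', Nat.unpair_pair]

theorem infinite_posAbove (f : ℕ → ℕ) : (posAbove f).Infinite :=
  Set.infinite_of_injective_forall_mem (f := fun k : ℕ => (0, f 0 + k))
    (fun i j hij => by simpa using hij) fun k => Nat.le_add_right _ _

theorem infinite_posBelow {f : ℕ → ℕ} (hf : ∀ n, 0 < f n) : (posBelow f).Infinite :=
  Set.infinite_of_injective_forall_mem (f := fun k : ℕ => (k, 0))
    (fun i j hij => by simpa using hij) fun k => hf k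

theorem exists_orderings {f : ℕ → ℕ} (hf : Computable f) (hinf : (posBelow f).Infinite) :
    (∃ a, IsComputableOrdering (posAbove f) a) ∧ ∃ b, IsComputableOrdering (posBelow f) b := by
  have hA := computable_aboveSet hf
  refine ⟨exists_isComputableOrdering hA (infinite_posAbove f) fun p => aboveSet_eq_true,
    exists_isComputableOrdering (c := fun p => !aboveSet f p)
      (Primrec.not.to_comp.comp hA) hinf fun p => ?_⟩
  rw [Bool.not_eq_true', aboveSet_eq_false]

/-- The positions listed by `e`, as numbers. -/
def pairPos (e : ℕ → ℕ × ℕ) (n : ℕ) : ℕ := Nat.pair (e n).1 (e n).2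

theorem bitsAlong_eq (e : ℕ → ℕ × ℕ) (ω : BitArray) : bitsAlong e ω = join ω ∘ pairPos e := by
  funext n
  simp [bitsAlong, join, pairPos]

theorem exists_isSplitting {f : ℕ → ℕ} (hf : Computable f) {a b : ℕ → ℕ × ℕ}
    (ha : IsComputableOrdering (posAbove f) a) (hb : IsComputableOrdering (posBelow f) b) :
    ∃ inv, IsSplitting (aboveSet f) (pairPos a) (pairPos b) inv := by
  have hpos : ∀ {e : ℕ → ℕ × ℕ}, Computable e → Computable (pairPos e) := fun he =>
    computable_nat_pair.comp (Computable.fst.comp he) (Computable.snd.comp he)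
  have hinj : ∀ {e : ℕ → ℕ × ℕ}, Function.Injective e → Function.Injective (pairPos e) := by
    intro e he n m h
    have := Nat.pair_eq_pair.1 h
    exact he (Prod.ext this.1 this.2)
  have hA : ∀ n, aboveSet f (pairPos a n) = true := fun n => by
    rw [aboveSet_eq_true, ← ha.range_eq]
    exact ⟨n, by simp [pairPos]⟩
  have hB : ∀ n, aboveSet f (pairPos b n) = false := fun n => by
    rw [aboveSet_eq_false, ← hb.range_eq]
    exact ⟨n, by simp [pairPos]⟩
  have hex : ∀ p, ∃ n, (decide (pairPos a n = p) || decide (pairPos b n = p)) = true := by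
    intro p
    cases h : aboveSet f p
    · rw [aboveSet_eq_false, ← hb.range_eq] at h
      obtain ⟨n, hn⟩ := h
      exact ⟨n, by simp [pairPos, hn]⟩
    · rw [aboveSet_eq_true, ← ha.range_eq] at h
      obtain ⟨n, hn⟩ := h
      exact ⟨n, by simp [pairPos, hn]⟩
  refine ⟨fun p => Nat.find (hex p), computable_aboveSet hf, hpos ha.computable,
    hpos hb.computable, computable_find (p := fun p n =>
      decide (pairPos a n = p) || decide (pairPos b n = p)) ?_ hex fun _ => rfl,
    fun p hp => ?_, fun p hp => ?_, hA, hB, hinj ha.injective, hinj hb.injective⟩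
  · exact computable_bool_or.comp
      (computable_nat_eq.comp ((hpos ha.computable).comp Computable.snd) Computable.fst)
      (computable_nat_eq.comp ((hpos hb.computable).comp Computable.snd) Computable.fst)
  · have := Nat.find_spec (hex p)
    rw [Bool.or_eq_true, decide_eq_true_eq, decide_eq_true_eq] at this
    refine this.resolve_right fun h => ?_
    have := hB (Nat.find (hex p))
    rw [h, hp] at this
    cases this
  · have := Nat.find_spec (hex p)
    rw [Bool.or_eq_true, decide_eq_true_eq, decide_eq_true_eq] at this
    refine this.resolve_left fun h => ?_
    have := hA (Nat.find (hex p))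
    rw [h, hp] at this
    cases this

namespace IsSplitting

variable {A : ℕ → Bool} {a b inv : ℕ → ℕ}

theorem inv_right (h : IsSplitting A a b inv) (n : ℕ) : inv (b n) = n :=
  h.injective_right (h.right_inv _ (h.set_right n))

theorem merge_eq (h : IsSplitting A a b inv) (x : Cantor) :
    merge A inv (x ∘ a) (x ∘ b) = x := by
  funext p
  cases hp : A p
  · simp [merge, hp, h.right_inv p hp]
  · simp [merge, hp, h.left_inv p hp]

theorem isFiltration_stage (h : IsSplitting A a b inv) : IsFiltration (stage A inv) where
  computable := computable_bool_or.comp (h.computable_set.comp Computable.snd)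
    (computable_nat_lt.comp (h.computable_inv.comp Computable.snd) Computable.fst)
  mono m n hmn p hp := by
    simp only [stage, Bool.or_eq_true, decide_eq_true_eq] at hp ⊢
    exact hp.imp_right fun h => lt_of_lt_of_le h hmn

theorem injective_right_add (h : IsSplitting A a b inv) (n : ℕ) :
    Function.Injective fun k => b (k + n) := fun i j hij => by
  have := h.injective_right hij
  omega

end IsSplitting

/-- If membership in `K n` puts a position into `J m` as soon as `m` exceeds one of finitely many
computable values, then each `K n` is contained in some `J (l n)` with `l` computable. -/
theorem exists_computable_time {J K : ℕ → ℕ → Bool} (hJ : IsFiltration J) {g : ℕ → ℕ}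
    (hg : Computable g) {u : ℕ → ℕ} (hu : Computable u)
    (h : ∀ n p, K n p = true → J 0 p = true ∨ ∃ i < u n, ∀ m, g i < m → J m p = true) :
    ∃ l, Computable l ∧ (∀ n p, K n p = true → J (l n) p = true) ∧ ∀ n, n ≤ l n := by
  refine ⟨fun n => n + (Finset.range (u n)).sup fun i => g i + 1, ?_, fun n p hp => ?_,
    fun n => Nat.le_add_right _ _⟩
  · refine computable_nat_add.comp Computable.id ((computable_sup (α := Unit)
      (g := fun q => g q.2 + 1) ?_).comp ((Computable.const ()).pair hu))
    exact Computable.succ.comp (hg.comp Computable.snd)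
  · rcases h n p hp with h0 | ⟨i, hi, h1⟩
    · exact hJ.mono 0 _ (Nat.zero_le _) p h0
    · refine h1 _ ?_
      have := Finset.le_sup (f := fun i => g i + 1) (Finset.mem_range.2 hi)
      dsimp only at this ⊢
      omega

/-! ### Uniform martingale tests -/

theorem IsCauchyName.abs_sub_le {p : ℕ → ℕ} {x : ℝ} (h : IsCauchyName p x) (k : ℕ) :
    |(ratOfCode (p k) : ℝ) - x| ≤ (1 / 2 : ℝ) ^ k := by
  have h1 : Tendsto (fun n => |(ratOfCode (p n) : ℝ) - ratOfCode (p k)|) atTop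
      (𝓝 |x - ratOfCode (p k)|) := (h.2.sub_const _).abs
  rw [abs_sub_comm]
  exact le_of_tendsto h1 ((eventually_ge_atTop k).mono fun n hn => h.1 k n hn)

theorem IsCauchyName.abs_posPart_sub_le {p : ℕ → ℕ} {x : ℝ} (h : IsCauchyName p x) (hx : 0 ≤ x)
    (k : ℕ) : |((max (ratOfCode (p k)) 0 : ℚ) : ℝ) - x| ≤ (1 / 2 : ℝ) ^ k := by
  have h1 := h.abs_sub_le k
  have h2 : |max (ratOfCode (p k) : ℝ) 0 - max x 0| ≤ |(ratOfCode (p k) : ℝ) - x| :=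
    abs_max_sub_max_le_abs _ _ _
  rw [max_eq_left hx] at h2
  push_cast
  exact h2.trans h1

theorem isCauchyName_const (i : ℕ) : IsCauchyName (fun _ => i) (ratOfCode i) :=
  ⟨fun m n _ => by simp, tendsto_const_nhds⟩

theorem abs_integral_sub_integral_le {α : Type} [MeasurableSpace α] {μ : Measure α}
    [IsProbabilityMeasure μ] {g h : α → ℝ} (hg : Integrable g μ) (hh : Integrable h μ) {ε : ℝ}
    (hgh : ∀ x, |g x - h x| ≤ ε) : |∫ x, g x ∂μ - ∫ x, h x ∂μ| ≤ ε := by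
  rw [← integral_sub hg hh]
  have := norm_integral_le_of_norm_le_const (μ := μ) (f := fun x => g x - h x) (C := ε)
    (.of_forall hgh)
  simpa using this

theorem isTruthTable_initSeg : IsTruthTable fun (γ : Cantor) (n : ℕ) => initSeg γ n := by
  have h1 : Computable fun p : List Bool × ℕ => initSeg (fun i => p.1.getD i false) p.2 :=
    computable_initSeg (b := fun (l : List Bool) i => l.getD i false)
      (Primrec.list_getD false).to_comp
  exact ⟨id, _, Computable.id, h1, fun γ n s hs =>
    initSeg_congr fun i hi => getD_initSeg γ (lt_of_lt_of_le hi hs)⟩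

/-- Two quantities that are close to the same sequence converge together. -/
theorem exists_tendsto_of_abs_sub_le {y z : ℕ → ℝ}
    (h : ∀ n, |y n - z n| ≤ (1 / 2 : ℝ) ^ (n + 2)) :
    (∃ a, Tendsto y atTop (𝓝 a)) → ∃ a, Tendsto z atTop (𝓝 a) := by
  rintro ⟨a, ha⟩
  have h1 : Tendsto (fun n => y n - z n) atTop (𝓝 0) :=
    squeeze_zero_norm h ((tendsto_pow_atTop_nhds_zero_of_lt_one (by norm_num)
      (by norm_num)).comp (tendsto_add_atTop_nat 2))
  exact ⟨a, by simpa using ha.sub h1⟩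

theorem not_tendsto_of_limsup_eq_top {y : ℕ → ℝ}
    (h : limsup (fun n => (y n : EReal)) atTop = ⊤) : ¬ ∃ a, Tendsto y atTop (𝓝 a) := by
  rintro ⟨a, ha⟩
  have h1 : Tendsto (fun n => (y n : EReal)) atTop (𝓝 (a : EReal)) :=
    (continuous_coe_real_ereal.tendsto a).comp ha
  rw [h1.limsup_eq] at h
  exact EReal.coe_ne_top a h

section Tests

variable {A : ℕ → Bool} {a b inv : ℕ → ℕ} {M : Cantor → ℕ → Cantor → ℝ}

theorem IsSplitting.mix_comp_left (h : IsSplitting A a b inv) (n : ℕ) (x y : Cantor) :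
    mix (stage A inv n) x y ∘ a = x ∘ a := by
  funext k
  exact mix_of_true (by simp [stage, h.set_left]) x y

theorem IsSplitting.mix_comp_right (h : IsSplitting A a b inv) (n : ℕ) (x y : Cantor) :
    mix (stage A inv n) x y ∘ b = seqConcat (x ∘ b) n fun k => y (b (k + n)) := by
  funext k
  by_cases hk : k < n
  · simp only [seqConcat, hk, if_true]
    exact mix_of_true (by simp [stage, h.inv_right, hk]) x y
  · simp only [seqConcat, hk, if_false, Nat.sub_add_cancel (not_lt.1 hk)]
    exact mix_of_false (by simp [stage, h.inv_right, hk, h.set_right]) x y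

theorem dependsOn_comp_seqConcat {g : Cantor → ℝ} {u : ℕ} (hg : DependsOn g (Set.Iio u))
    (α : Cantor) (n : ℕ) : DependsOn (fun β => g (seqConcat α n β)) (Set.Iio u) := by
  intro β β' h
  refine hg fun k hk => ?_
  simp only [seqConcat]
  split_ifs with hkn
  · rfl
  · exact h _ (lt_of_le_of_lt (Nat.sub_le k n) hk)

/-- A uniform martingale test, read off from the two parts of one sequence, is approximated by
rational functions of finitely many bits. -/
theorem IsUniformMartingaleTest.exists_isApproxMartingale (h : IsSplitting A a b inv)
    (hM : IsUniformMartingaleTest M) : ∃ q, IsApproxMartingale (stage A inv) q ∧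
      ∀ n x, |(q n x : ℝ) - M (x ∘ a) n (x ∘ b)| ≤ (1 / 2 : ℝ) ^ (n + 2) := by
  obtain ⟨h0, Φ, hΦ, hΦM⟩ := hM
  have hΦ := hΦ.isTruthTable
  have happrox : ∀ n x, |((max (ratOfCode (Φ (x ∘ a)
      (Encodable.encode (initSeg (x ∘ b) n, n + 2)))) 0 : ℚ) : ℝ) - M (x ∘ a) n (x ∘ b)| ≤
      (1 / 2 : ℝ) ^ (n + 2) := fun n x =>
    ((hΦM (x ∘ a)).2 n (x ∘ b)).abs_posPart_sub_le (h0 _ _ _) (n + 2)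
  refine ⟨fun n x => max (ratOfCode (Φ (x ∘ a)
    (Encodable.encode (initSeg (x ∘ b) n, n + 2)))) 0, ?_, happrox⟩
  have hcomp : IsTruthTable fun (x : Cantor) (n : ℕ) =>
      Φ (x ∘ a) (Encodable.encode (initSeg (x ∘ b) n, n + 2)) := by
    have h1 : IsTruthTable fun (x : Cantor) (m : ℕ) => Φ (x ∘ a) m :=
      hΦ.subst (isTruthTable_eval.comp_computable
        (h.computable_left.comp (Computable.snd (α := ℕ) (β := ℕ))))
    have h2 : IsTruthTable fun (x : Cantor) (n : ℕ) => initSeg (x ∘ b) n :=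
      isTruthTable_initSeg.subst (isTruthTable_eval.comp_computable
        (h.computable_right.comp (Computable.snd (α := ℕ) (β := ℕ))))
    have h3 : IsTruthTable fun (_ : Cantor) (n : ℕ) => n + 2 :=
      isTruthTable_of_computable (Computable.succ.comp Computable.succ)
    exact h1.comp (isTruthTable_comp Computable.encode (h2.pair h3))
  have hrat := hcomp.ratOfCode.posPart
  refine ⟨hrat, fun n x => le_max_right _ _, fun n x y hxy => ?_, fun n x => ?_⟩
  · have e1 : x ∘ a = y ∘ a := funext fun k => hxy _ (by simp [stage, h.set_left])
    have e2 : initSeg (x ∘ b) n = initSeg (y ∘ b) n :=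
      initSeg_congr fun k hk => hxy _ (by simp [stage, h.inv_right, hk])
    rw [e1, e2]
  · -- the martingale at time `n + 1`, as a function of the bits still to come
    set g : Cantor → ℝ := fun β => M (x ∘ a) (n + 1) (seqConcat (x ∘ b) n β) with hg_def
    have hg : DependsOn g (Set.Iio (n + 1)) :=
      dependsOn_comp_seqConcat ((hΦM (x ∘ a)).1.adapted (n + 1)) _ _
    have hmp := measurePreserving_comp_injective (h.injective_right_add n)
    have hgM : ∫ y : Cantor, g (y ∘ fun k => b (k + n)) ∂(uniformMeasure ℕ) =
        M (x ∘ a) n (x ∘ b) := by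
      rw [integral_comp_of_measurePreserving hmp (measurable_of_dependsOn hg)]
      exact congrFun ((hΦM (x ∘ a)).1.condExp_eq n (n + 1) (Nat.le_succ n)) (x ∘ b)
    have hgint : Integrable (fun y : Cantor => g (y ∘ fun k => b (k + n))) (uniformMeasure ℕ) :=
      hmp.integrable_comp_of_integrable (integrable_of_dependsOn hg)
    obtain ⟨u, -, hu⟩ := hrat.dependsOn
    have hqint : Integrable (fun y => (((max (ratOfCode (Φ (mix (stage A inv n) x y ∘ a)
        (Encodable.encode (initSeg (mix (stage A inv n) x y ∘ b) (n + 1), n + 1 + 2)))) 0 : ℚ)) :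
          ℝ)) (uniformMeasure ℕ) :=
      integrable_of_dependsOn (u := u (n + 1)) fun y z hyz =>
        congrArg Rat.cast (dependsOn_comp_mix (hu (n + 1)) (stage A inv n) x hyz)
    have h1 := abs_integral_sub_integral_le hqint hgint (ε := (1 / 2 : ℝ) ^ (n + 1 + 2))
      fun y => by
        have := happrox (n + 1) (mix (stage A inv n) x y)
        rw [h.mix_comp_left, h.mix_comp_right] at this
        rw [h.mix_comp_left, h.mix_comp_right]
        exact this
    rw [hgM] at h1
    have h2 := happrox n x
    rw [abs_sub_comm] at h2
    refine (abs_sub_le _ _ _).trans ((add_le_add h1 h2).trans ?_)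
    have h3 : (0 : ℝ) < (1 / 2 : ℝ) ^ n := by positivity
    rw [pow_add, pow_add, pow_add]
    linarith

/-- An exact martingale for the filtration `stage A inv` is a uniform martingale test. -/
theorem IsExactMartingale.isUniformMartingaleTest (h : IsSplitting A a b inv)
    {D : ℕ → Cantor → ℚ} (hD : IsExactMartingale (stage A inv) D) :
    IsUniformMartingaleTest fun γ n α => (D n (merge A inv γ α) : ℝ) := by
  refine ⟨fun γ n α => Rat.cast_nonneg.2 (hD.nonneg _ _), ?_⟩
  obtain ⟨c, hc, hcD⟩ := hD.computable
  have hdep : ∀ γ n, DependsOn (fun α => D n (merge A inv γ α)) (Set.Iio n) := by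
    intro γ n α α' hα
    refine hD.adapted n fun p hp => ?_
    have hp : stage A inv n p = true := hp
    rw [stage, Bool.or_eq_true, decide_eq_true_eq] at hp
    rcases hp with hp | hp
    · simp [merge, hp]
    · simp [merge, hα (inv p) hp]
  have hdep' : ∀ γ n, DependsOn (fun α => (D n (merge A inv γ α) : ℝ)) (Set.Iio n) :=
    fun γ n α α' hα => congrArg Rat.cast (hdep γ n hα)
  -- the code of the value depends on the string alone
  have hmerge : IsTruthTable fun (γ : Cantor) (r : List Bool × ℕ) =>
      merge A inv γ (fun i => r.1.getD i false) r.2 := by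
    have h1 : Computable fun r : List Bool × ℕ => A r.2 := h.computable_set.comp Computable.snd
    have h2 : Computable fun r : List Bool × ℕ => inv r.2 := h.computable_inv.comp Computable.snd
    have h3 : Computable fun r : List Bool × ℕ => r.1.getD (inv r.2) false :=
      (Primrec.list_getD false).to_comp.comp Computable.fst h2
    have h4 : Computable fun r : Bool × Bool × Bool => bif r.1 then r.2.1 else r.2.2 :=
      Computable.cond Computable.fst (Computable.fst.comp Computable.snd)
        (Computable.snd.comp Computable.snd)
    exact isTruthTable_comp h4 ((isTruthTable_of_computable h1).pair
      ((isTruthTable_eval.comp_computable h2).pair (isTruthTable_of_computable h3)))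
  have hdecode : Computable fun m : ℕ =>
      ((Encodable.decode m : Option (List Bool × ℕ)).getD ([], 0)).1 :=
    Computable.fst.comp (Computable.option_getD Computable.decode (Computable.const _))
  have hΦ := ((hc.comp_computable (Computable.list_length (α := Bool))).subst
    hmerge).comp_computable hdecode
  refine ⟨_, hΦ.isComputableFunctional, fun γ => ⟨⟨fun n => integrable_of_dependsOn (hdep' γ n),
    hdep' γ, fun m n hmn => ?_⟩, fun n α => ?_⟩⟩
  · funext α
    dsimp only
    rw [← hD.condE_eq m n hmn]
    obtain ⟨u, -, hu⟩ := hD.computable.dependsOn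
    refine integral_eq_condE (h.injective_right_add m) (c := fun β =>
      merge A inv γ (seqConcat α m β)) ?_ (fun y => ?_) (measurable_of_dependsOn (u := u n)
        fun x y hxy => congrArg Rat.cast (hu n hxy))
    · refine measurable_pi_lambda _ fun p => ?_
      simp only [merge, seqConcat]
      cases A p
      · simp only [cond_false]
        split_ifs
        · exact measurable_const
        · exact measurable_pi_apply _
      · exact measurable_const
    · funext p
      cases hA : A p
      · by_cases hp : inv p < m
        · rw [mix_of_true (by simp [stage, hp])]
          simp [merge, seqConcat, hA, hp]
        · rw [mix_of_false (by simp [stage, hp, hA])]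
          simp [merge, seqConcat, hA, hp, Nat.sub_add_cancel (not_lt.1 hp), h.right_inv p hA]
      · rw [mix_of_true (by simp [stage, hA])]
        simp [merge, hA]
  · simp only [Encodable.encodek, Option.getD_some, length_initSeg]
    have e : D n (merge A inv γ α) =
        ratOfCode (c (fun i => merge A inv γ (fun i => (initSeg α n).getD i false) i) n) := by
      rw [hcD]
      exact hdep γ n fun i hi => (getD_initSeg α hi).symm
    rw [e]
    exact isCauchyName_const _

theorem not_computablyRandomUniformlyRel_of_tendsto (h : IsSplitting A a b inv)
    {D : ℕ → Cantor → ℚ} (hD : IsExactMartingale (stage A inv) D) {x : Cantor}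
    (hx : Tendsto (fun n => D n x) atTop atTop) :
    ¬ ComputablyRandomUniformlyRel (x ∘ b) (x ∘ a) := by
  refine fun hcr => hcr ⟨_, hD.isUniformMartingaleTest h, ?_⟩
  have h1 : Tendsto (fun n => ((D n x : ℝ) : EReal)) atTop (𝓝 ⊤) :=
    EReal.tendsto_coe_atTop.comp (tendsto_ratCast_atTop_iff.2 hx)
  simp only [h.merge_eq]
  exact h1.limsup_eq

end Tests

/-! ### Row martingales -/

/-- The bit array with the bits of the sequence `x`; the inverse of `join`. -/
def unjoin (x : Cantor) : BitArray := fun p => x (Nat.pair p.1 p.2)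

@[simp] theorem join_unjoin (x : Cantor) : join (unjoin x) = x := by
  funext p
  simp [join, unjoin]

@[simp] theorem unjoin_join (ω : BitArray) : unjoin (join ω) = ω := by
  funext p
  simp [join, unjoin]

theorem continuous_unjoin : Continuous unjoin := by
  unfold unjoin
  fun_prop

theorem continuous_join : Continuous join := by
  unfold join
  fun_prop

theorem continuous_rowConcat_left (m : ℕ) (ξ : BitArray) :
    Continuous fun ω => rowConcat ω m ξ := by
  refine continuous_pi fun p => ?_
  simp only [rowConcat]
  split_ifs
  · exact continuous_apply p
  · exact continuous_const

theorem continuous_rowConcat_right (m : ℕ) (ω : BitArray) :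
    Continuous fun ξ => rowConcat ω m ξ := by
  refine continuous_pi fun p => ?_
  simp only [rowConcat]
  split_ifs
  · exact continuous_const
  · exact continuous_apply _

/-- The position, in the joined sequence, of a bit of an array placed below the first `n` rows. -/
def shiftRows (n : ℕ) (p : ℕ × ℕ) : ℕ := Nat.pair (p.1 + n) p.2

theorem injective_shiftRows (n : ℕ) : Function.Injective (shiftRows n) := by
  intro p q h
  have := Nat.pair_eq_pair.1 h
  exact Prod.ext (by omega) this.2

theorem join_rowConcat (n : ℕ) (ω : BitArray) (y : Cantor) :
    join (rowConcat ω n (y ∘ shiftRows n)) = mix (rowsBelow n) (join ω) y := by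
  funext p
  by_cases hp : p.unpair.1 < n
  · rw [mix_of_true (by simp [rowsBelow, hp])]
    simp [join, rowConcat, hp]
  · rw [mix_of_false (by simp [rowsBelow, hp])]
    simp [join, rowConcat, hp, shiftRows, Nat.sub_add_cancel (not_lt.1 hp)]

theorem rowCondExp_comp_join {g : Cantor → ℝ} (hg : Measurable g) (n : ℕ) (ω : BitArray) :
    rowCondExp n (fun ω => g (join ω)) ω = condE (rowsBelow n) g (join ω) :=
  integral_eq_condE (injective_shiftRows n) (c := fun ξ => join (rowConcat ω n ξ))
    (continuous_join.comp (continuous_rowConcat_right n ω)).measurable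
    (fun y => join_rowConcat n ω y) hg

/-- An exact martingale for the filtration by rows is a computable row martingale. -/
theorem IsExactMartingale.not_isDoobRandom {D : ℕ → Cantor → ℚ}
    (hD : IsExactMartingale rowsBelow D) {ω : BitArray}
    (hω : Tendsto (fun n => D n (join ω)) atTop atTop) : ¬ IsDoobRandom ω := by
  intro hdoob
  obtain ⟨u, -, hu⟩ := hD.computable.dependsOn
  have hu' : ∀ n, DependsOn (fun x => (D n x : ℝ)) (Set.Iio (u n)) := fun n x y h =>
    congrArg Rat.cast (hu n h)
  have hjoin : MeasurePreserving join (uniformMeasure (ℕ × ℕ)) (uniformMeasure ℕ) :=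
    measurePreserving_comp_injective (e := Nat.unpair) Nat.pairEquiv.symm.injective
  have hrow : IsRowMartingale fun n ω => (D n (join ω) : ℝ) := by
    refine ⟨fun n => hjoin.integrable_comp_of_integrable (integrable_of_dependsOn (hu' n)),
      fun n => ⟨_, fun ω ω' h => ?_, ae_eq_refl _⟩, fun m n hmn => .of_forall fun ω => ?_⟩
    · refine congrArg Rat.cast (hD.adapted n fun p hp => h p.unpair ?_)
      have hp : rowsBelow n p = true := hp
      rw [rowsBelow, decide_eq_true_eq] at hp
      exact hp
    · dsimp only
      rw [← hD.condE_eq m n hmn]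
      exact rowCondExp_comp_join (measurable_of_dependsOn (hu' n)) m ω
  have hcomp : IsComputableRowSeq fun n ω => (D n (join ω) : ℝ) := by
    obtain ⟨c, hc, hcD⟩ := hD.computable
    refine ⟨fun x p => c x p.1, (hc.comp_computable Computable.fst).isComputableFunctional,
      fun n ω => ?_⟩
    have := isCauchyName_const (c (join ω) n)
    rwa [hcD] at this
  obtain ⟨a, ha⟩ := hdoob _ hrow hcomp fun n ξ => Rat.cast_nonneg.2 (hD.nonneg _ _)
  exact not_tendsto_nhds_of_tendsto_atTop (tendsto_ratCast_atTop_iff.2 hω) a ha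

theorem continuous_of_dependsOn {g : Cantor → ℝ} {u : ℕ} (hg : DependsOn g (Set.Iio u)) :
    Continuous g := by
  rw [continuous_def]
  intro s _
  convert isOpen_initSeg (fun l => g (fun i => l.getD i false) ∈ s) u using 1
  ext x
  have : g (fun i => (initSeg x u).getD i false) = g x := hg fun i hi => getD_initSeg x hi
  simp only [Set.mem_preimage, Set.mem_ofPred_eq, this]

section RowMartingale

variable {M : ℕ → BitArray → ℝ} {F : Cantor → ℕ × ℕ → ℕ}

theorem continuous_of_isTruthTable (hF : IsTruthTable F)
    (hFM : ∀ n ω, IsCauchyName (fun k => F (join ω) (n, k)) (M n ω)) (n : ℕ) :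
    Continuous (M n) := by
  refine continuous_of_uniform_approx_of_continuous fun U hU => ?_
  obtain ⟨ε, hε, hεU⟩ := Metric.mem_uniformity_dist.1 hU
  obtain ⟨k, hk⟩ := exists_pow_lt_of_lt_one hε (by norm_num : (1 / 2 : ℝ) < 1)
  obtain ⟨u, -, hu⟩ := hF.ratOfCode.dependsOn
  refine ⟨fun ω => (ratOfCode (F (join ω) (n, k)) : ℝ), ?_, fun ω => hεU ?_⟩
  · exact (continuous_of_dependsOn (u := u (n, k)) fun x y h =>
      congrArg Rat.cast (hu (n, k) h)).comp continuous_join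
  · rw [dist_comm, Real.dist_eq]
    exact ((hFM n ω).abs_sub_le k).trans_lt hk

/-- Since both sides are continuous, the martingale equations hold everywhere. -/
theorem IsRowMartingale.rowCondExp_eq (hM : IsRowMartingale M) (hc : ∀ n, Continuous (M n))
    {m n : ℕ} (h : m ≤ n) : rowCondExp m (M n) = M m := by
  refine Continuous.ae_eq_iff_eq (uniformMeasure (ℕ × ℕ)) ?_ (hc m) |>.1 (hM.condExp_eq m n h)
  obtain ⟨B, hB⟩ := isCompact_univ.exists_bound_of_continuousOn (hc n).continuousOn
  refine continuous_of_dominated (bound := fun _ => B) (fun ω => ?_) (fun ω => ?_)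
    (integrable_const _) ?_
  · exact ((hc n).comp (continuous_rowConcat_right m ω)).aestronglyMeasurable
  · exact .of_forall fun ξ => hB _ (Set.mem_univ _)
  · exact .of_forall fun ξ => (hc n).comp (continuous_rowConcat_left m ξ)

theorem IsRowMartingale.dependsOn (hM : IsRowMartingale M) (hc : ∀ n, Continuous (M n)) (n : ℕ) :
    DependsOn (M n) {p : ℕ × ℕ | p.1 < n} := by
  intro ω ω' h
  rw [← hM.rowCondExp_eq hc (le_refl n), rowCondExp, rowCondExp]
  congr 1
  funext ξ
  congr 1
  funext p
  simp only [rowConcat]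
  split_ifs with hp
  · exact h p hp
  · rfl

/-- A computable row martingale is approximated by rational functions `q n` of finitely many bits.
If `f n` bounds the columns on which `q (n + 1)` depends, then the bits of the `n`th row on or above
the graph of `f` have no influence on the conditional expectation of `q (n + 1)`; they may
therefore be regarded as known in advance. -/
theorem IsRowMartingale.exists_isApproxMartingale (hM : IsRowMartingale M)
    (hcM : IsComputableRowSeq M) (h0 : ∀ n ξ, 0 ≤ M n ξ) :
    ∃ f : ℕ → ℕ, Computable f ∧ (∀ n, 0 < f n) ∧ ∃ q,
      IsApproxMartingale (fun n p => aboveSet f p || rowsBelow n p) q ∧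
      ∀ n x, |(q n x : ℝ) - M n (unjoin x)| ≤ (1 / 2 : ℝ) ^ (n + 2) := by
  obtain ⟨F, hF, hFM⟩ := hcM
  have hF := hF.isTruthTable
  have hc : ∀ n, Continuous (M n) := continuous_of_isTruthTable hF hFM
  -- the array is replaced by zeros below the first `n` rows
  let cut : ℕ → Cantor → Cantor := fun n x => mix (rowsBelow n) x fun _ => false
  have hcut : ∀ n x, M n (unjoin (cut n x)) = M n (unjoin x) := fun n x =>
    hM.dependsOn hc n fun p hp => by
      have hp : p.1 < n := hp
      exact mix_of_true (J := rowsBelow n) (p := Nat.pair p.1 p.2)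
        (by simp [rowsBelow, hp]) x fun _ => false
  let q : ℕ → Cantor → ℚ := fun n x => max (ratOfCode (F (cut n x) (n, n + 2))) 0
  have happrox : ∀ n x, |(q n x : ℝ) - M n (unjoin x)| ≤ (1 / 2 : ℝ) ^ (n + 2) := by
    intro n x
    have := (hFM n (unjoin (cut n x))).abs_posPart_sub_le (h0 _ _) (n + 2)
    rwa [hcut, join_unjoin] at this
  have hq : IsRatTruthTable fun x n => q n x := by
    have h1 : IsTruthTable fun (x : Cantor) (r : (ℕ × ℕ) × ℕ) =>
        bif rowsBelow r.1.1 r.2 then x r.2 else false := by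
      have h2 : Computable fun r : (ℕ × ℕ) × ℕ => rowsBelow r.1.1 r.2 :=
        isFiltration_rowsBelow.computable.comp (Computable.fst.comp Computable.fst) Computable.snd
      have h3 : Computable fun r : Bool × Bool => bif r.1 then r.2 else false :=
        Computable.cond Computable.fst Computable.snd (Computable.const false)
      exact isTruthTable_comp h3 ((isTruthTable_of_computable h2).pair
        (isTruthTable_eval.comp_computable Computable.snd))
    have h4 : Computable fun n : ℕ => (n, n + 2) :=
      Computable.id.pair (Computable.succ.comp Computable.succ)
    exact ((hF.subst h1).comp_computable h4).ratOfCode.posPart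
  obtain ⟨u, hu, hqu⟩ := hq.dependsOn
  have hqrows : ∀ n, AdaptedTo (rowsBelow n) (q n) := fun n x y h => by
    have : cut n x = cut n y := by
      funext p
      cases hp : rowsBelow n p
      · simp only [cut, mix_of_false hp]
      · simp only [cut, mix_of_true hp, h p hp]
    simp only [q, this]
  refine ⟨fun n => u (n + 1) + 1, Computable.succ.comp (hu.comp Computable.succ),
    fun n => Nat.succ_pos _, q, ⟨hq, fun n x => le_max_right _ _, fun n x y h =>
      hqrows n fun p hp => h p ?_, fun n x => ?_⟩, happrox⟩
  · have hp : rowsBelow n p = true := hp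
    simp [hp]
  · have hmix : ∀ y, q (n + 1) (mix (fun p => aboveSet (fun n => u (n + 1) + 1) p ||
        rowsBelow n p) x y) = q (n + 1) (mix (rowsBelow n) x y) := by
      intro y
      rw [← (hqrows (n + 1)).mix _ fun _ => false,
        ← (hqrows (n + 1)).mix (mix (rowsBelow n) x y) fun _ => false]
      refine hqu (n + 1) fun p hp => ?_
      have hp : p < u (n + 1) := hp
      cases h1 : rowsBelow (n + 1) p
      · rw [mix_of_false h1, mix_of_false h1]
      rw [mix_of_true h1, mix_of_true h1]
      cases h2 : rowsBelow n p
      · -- the position is in row `n`, and so it is below the graph of `f`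
        rw [mix_of_false h2]
        refine mix_of_false ?_ x y
        simp only [rowsBelow, decide_eq_true_eq, decide_eq_false_iff_not] at h1 h2
        have h3 : p.unpair.1 = n := by omega
        have h4 : p.unpair.2 ≤ p := Nat.unpair_right_le p
        simp only [rowsBelow, aboveSet, h3, lt_self_iff_false, decide_false, Bool.or_false,
          decide_eq_false_iff_not]
        omega
      · rw [mix_of_true h2]
        exact mix_of_true (by simp [h2]) x y
    have hcont : Continuous fun x => M (n + 1) (unjoin x) := (hc (n + 1)).comp continuous_unjoin
    have hcond : condE (rowsBelow n) (fun x => M (n + 1) (unjoin x)) x = M n (unjoin x) := by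
      have h1 := rowCondExp_comp_join hcont.measurable n (unjoin x)
      simp only [unjoin_join, join_unjoin] at h1
      rw [← h1, ← hM.rowCondExp_eq hc (Nat.le_succ n)]
    have hqint : Integrable (fun y => (q (n + 1) (mix (rowsBelow n) x y) : ℝ))
        (uniformMeasure ℕ) :=
      integrable_of_dependsOn (u := u (n + 1)) fun y z hyz =>
        congrArg Rat.cast (dependsOn_comp_mix (hqu (n + 1)) (rowsBelow n) x hyz)
    have hMint : Integrable (fun y => M (n + 1) (unjoin (mix (rowsBelow n) x y)))
        (uniformMeasure ℕ) := by
      obtain ⟨B, hB⟩ := isCompact_univ.exists_bound_of_continuousOn hcont.continuousOn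
      refine Integrable.of_bound (C := B) ?_ (.of_forall fun y => hB _ (Set.mem_univ _))
      exact (hcont.measurable.comp ((measurable_mix (rowsBelow n)).comp
        measurable_prodMk_left)).aestronglyMeasurable
    have h1 := abs_integral_sub_integral_le hqint hMint (ε := (1 / 2 : ℝ) ^ (n + 1 + 2))
      fun y => happrox (n + 1) (mix (rowsBelow n) x y)
    have h2 := happrox n x
    rw [abs_sub_comm] at h2
    simp only [condE] at hcond ⊢
    simp only [hmix]
    rw [hcond] at h1
    refine (abs_sub_le _ _ _).trans ((add_le_add h1 h2).trans ?_)
    have h3 : (0 : ℝ) < (1 / 2 : ℝ) ^ n := by positivity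
    rw [pow_add, pow_add, pow_add]
    linarith

end RowMartingale

/-! ### Changing the filtration -/

section Change

variable {A : ℕ → Bool} {a b inv : ℕ → ℕ}

theorem exists_stage (A : ℕ → Bool) (inv : ℕ → ℕ) (p : ℕ) : ∃ n, stage A inv n p = true :=
  ⟨inv p + 1, by simp [stage]⟩

/-- A test that succeeds on the two parts of a sequence gives an exact martingale, for any
filtration whose members are contained in those of `stage A inv`, that tends to infinity. -/
theorem exists_exactMartingale_of_test (h : IsSplitting A a b inv) {x : Cantor}
    (hx : ¬ ComputablyRandomUniformlyRel (x ∘ b) (x ∘ a)) {K : ℕ → ℕ → Bool}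
    (hK : IsFiltration K) (hKex : ∀ p, ∃ n, K n p = true) {u : ℕ → ℕ} (hu : Computable u)
    (hKu : ∀ n p, K n p = true → A p = false → p < u n) :
    ∃ D, IsExactMartingale K D ∧ Tendsto (fun n => D n x) atTop atTop := by
  obtain ⟨M, hM, hlim⟩ := not_not.1 hx
  obtain ⟨q, hq, hqM⟩ := hM.exists_isApproxMartingale h
  obtain ⟨l, hl, hKl, hln⟩ := exists_computable_time (K := K) h.isFiltration_stage
    h.computable_inv hu fun n p hp => by
      cases hA : A p
      · exact .inr ⟨p, hKu n p hp hA, fun m hm => by simp [stage, hm]⟩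
      · exact .inl (by simp [stage, hA])
  exact exists_exactMartingale h.isFiltration_stage hK hKex hl hKl hln hq fun hconv =>
    not_tendsto_of_limsup_eq_top hlim (exists_tendsto_of_abs_sub_le (fun n => hqM n x) hconv)

/-- The second part of a sequence may be listed in any computable order. -/
theorem ComputablyRandomUniformlyRel.reorder {a' b' inv' : ℕ → ℕ} (h : IsSplitting A a b inv)
    (h' : IsSplitting A a' b' inv') {x : Cantor}
    (hx : ComputablyRandomUniformlyRel (x ∘ b) (x ∘ a)) :
    ComputablyRandomUniformlyRel (x ∘ b') (x ∘ a') := by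
  by_contra hx'
  have hu : Computable fun n => (Finset.range n).sup fun i => b i + 1 :=
    (computable_sup (α := Unit) (g := fun q => b q.2 + 1) (Computable.succ.comp
      (h.computable_right.comp Computable.snd))).comp ((Computable.const ()).pair Computable.id)
  obtain ⟨D, hD, hlim⟩ := exists_exactMartingale_of_test h' hx' h.isFiltration_stage
    (exists_stage A inv) hu fun n p hp hA => by
      have hp : inv p < n := by simpa [stage, hA] using hp
      have := Finset.le_sup (f := fun i => b i + 1) (Finset.mem_range.2 hp)
      rw [h.right_inv p hA] at this
      omega
  exact not_computablyRandomUniformlyRel_of_tendsto h hD hlim hx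

theorem IsDoobRandom.computablyRandomUniformlyRel {f : ℕ → ℕ} (hf : Computable f)
    (h : IsSplitting (aboveSet f) a b inv) {ω : BitArray} (hω : IsDoobRandom ω) :
    ComputablyRandomUniformlyRel (join ω ∘ b) (join ω ∘ a) := by
  by_contra hx
  have hu : Computable fun n => Nat.pair n ((Finset.range n).sup f) :=
    computable_nat_pair.comp Computable.id ((computable_sup (α := Unit) (g := fun q => f q.2)
      (hf.comp Computable.snd)).comp ((Computable.const ()).pair Computable.id))
  obtain ⟨D, hD, hlim⟩ := exists_exactMartingale_of_test h hx isFiltration_rowsBelow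
    (fun p => ⟨p.unpair.1 + 1, by simp [rowsBelow]⟩) hu fun n p hp hA => by
      rw [rowsBelow, decide_eq_true_eq] at hp
      have hA : p.unpair.2 < f p.unpair.1 := aboveSet_eq_false.1 hA
      have h1 := hA.le.trans (Finset.le_sup (f := f) (Finset.mem_range.2 hp))
      calc p = Nat.pair p.unpair.1 p.unpair.2 := (Nat.pair_unpair p).symm
        _ < Nat.pair n p.unpair.2 := Nat.pair_lt_pair_left _ hp
        _ ≤ Nat.pair n ((Finset.range n).sup f) := by
          rcases h1.lt_or_eq with h2 | h2
          · exact (Nat.pair_lt_pair_right _ h2).le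
          · exact h2 ▸ le_rfl
  exact hD.not_isDoobRandom hlim hω

/-- The converse: `f` is chosen in terms of the row martingale that is to converge. -/
theorem IsRowMartingale.exists_tendsto {M : ℕ → BitArray → ℝ} (hM : IsRowMartingale M)
    (hcM : IsComputableRowSeq M) (h0 : ∀ n ξ, 0 ≤ M n ξ) {ω : BitArray}
    (hω : ∀ f : ℕ → ℕ, Computable f → (∀ n, 0 < f n) → ∃ a b inv,
      IsSplitting (aboveSet f) a b inv ∧ ComputablyRandomUniformlyRel (join ω ∘ b) (join ω ∘ a)) :
    ∃ a : ℝ, Tendsto (fun n => M n ω) atTop (𝓝 a) := by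
  obtain ⟨f, hf, hfpos, q, hq, hqM⟩ := hM.exists_isApproxMartingale hcM h0
  obtain ⟨a, b, inv, h, hcr⟩ := hω f hf hfpos
  by_contra hconv
  have hJ := isFiltration_above_or_rowsBelow h.computable_set
  obtain ⟨l, hl, hKl, hln⟩ := exists_computable_time (K := stage (aboveSet f) inv)
    (g := fun i => (b i).unpair.1) hJ
    (Computable.fst.comp (Computable.unpair.comp h.computable_right)) Computable.id
    fun n p hp => by
      cases hA : aboveSet f p
      · refine .inr ⟨inv p, by simpa [stage, hA] using hp, fun m hm => ?_⟩
        rw [h.right_inv p hA] at hm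
        simp [rowsBelow, hm]
      · exact .inl (by simp)
  obtain ⟨D, hD, hlim⟩ := exists_exactMartingale (ω := join ω) hJ h.isFiltration_stage
    (exists_stage _ inv) hl hKl hln hq fun hq' => hconv (exists_tendsto_of_abs_sub_le
      (fun n => by simpa using hqM n (join ω)) hq')
  exact not_computablyRandomUniformlyRel_of_tendsto h hD hlim hcr

end Change

end DoobRand

open DoobRand
theorem mainTheorem1 :
    -- the sets involved do have computable orderings
    (∀ f : ℕ → ℕ, Computable f → (posBelow f).Infinite →
      (∃ a, IsComputableOrdering (posAbove f) a) ∧ (∃ b, IsComputableOrdering (posBelow f) b)) ∧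
    -- the choice of the orderings does not matter
    (∀ f : ℕ → ℕ, Computable f → (posBelow f).Infinite →
      ∀ a a' b b' : ℕ → ℕ × ℕ,
        IsComputableOrdering (posAbove f) a → IsComputableOrdering (posAbove f) a' →
        IsComputableOrdering (posBelow f) b → IsComputableOrdering (posBelow f) b' →
        ∀ ω : BitArray,
          (ComputablyRandomUniformlyRel (bitsAlong b ω) (bitsAlong a ω) ↔
            ComputablyRandomUniformlyRel (bitsAlong b' ω) (bitsAlong a' ω))) ∧
    -- the characterization
    (∀ ω : BitArray,
      IsDoobRandom ω ↔
        ∀ f : ℕ → ℕ, Computable f → (posBelow f).Infinite →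
          ∀ a b : ℕ → ℕ × ℕ,
            IsComputableOrdering (posAbove f) a → IsComputableOrdering (posBelow f) b →
              ComputablyRandomUniformlyRel (bitsAlong b ω) (bitsAlong a ω)) := by
  refine ⟨fun f hf hinf => exists_orderings hf hinf,
    fun f hf _ a a' b b' ha ha' hb hb' ω => ?_,
    fun ω => ⟨fun hω f hf _ a b ha hb => ?_, fun hω M hM hcM h0 => ?_⟩⟩
  · obtain ⟨inv, h⟩ := exists_isSplitting hf ha hb
    obtain ⟨inv', h'⟩ := exists_isSplitting hf ha' hb'
    simp only [bitsAlong_eq]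
    exact ⟨fun hx => hx.reorder h h', fun hx => hx.reorder h' h⟩
  · obtain ⟨inv, h⟩ := exists_isSplitting hf ha hb
    rw [bitsAlong_eq, bitsAlong_eq]
    exact hω.computablyRandomUniformlyRel hf h
  · refine hM.exists_tendsto hcM h0 fun f hf hfpos => ?_
    have hinf := infinite_posBelow hfpos
    obtain ⟨⟨a, ha⟩, b, hb⟩ := exists_orderings hf hinf
    obtain ⟨inv, h⟩ := exists_isSplitting hf ha hb
    have hcr := hω f hf hinf a b ha hb
    rw [bitsAlong_eq, bitsAlong_eq] at hcr
    exact ⟨_, _, inv, h, hcr⟩
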